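/- An instance of the conditional independence (CI) implication problem with cardinality bounds consists of natural numbers $m,n\ge 0$, a vector $R=\{(A_i,B_i,C_i): i\in\{1,\dots,m+1\}\}$ of triples of subsets of $\{1,\dots,n\}$, and a vector $K\in(\mathbb{N}\cup\{\infty\})^n$ of cardinality bounds, where $\infty$ means that the size of the finite domain is not restricted. The instance \emph{holds} if for all jointly distributed random variables $X_1,\dots,X_n$ with finite domains such that the domain of $X_j$ has at most $K_j$ elements for each $j$, \[ \bigwedge_{i\in\{1,\dots,m\}} \bigl(I(X_{A_i};X_{B_i}\mid X_{C_i})=0\bigr)\ \Rightarrow\ I(X_{A_{m+1}};X_{B_{m+1}}\mid X_{C_{m+1}})=0, \] where $X_A=(X_j)_{j\in A}$ and $I$ denotes conditional mutual information. An instance is written as a string over a finite alphabet, with $m$ and $n$ in unary, the subsets as characteristic vectors, and each $K_j$ in binary or as a symbol for $\infty$. \textbf{Theorem.} There is a map, computable in time polynomial in the length of the input string, that takes every instance $(R,K)$ to an instance $(R',K')$, with $R'=\{(A'_i,B'_i,C'_i): i\in\{1,\dots,m'+1\}\}$ a vector of triples of subsets of $\{1,\dots,n'\}$ and $K'\in(\mathbb{N}\cup\{\infty\})^{n'}$,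 such that (1) for every $i\in\{1,\dots,m'+1\}$ the sets $A'_i,B'_i,C'_i$ are pairwise disjoint; (2) $(R,K)$ holds if and only if $(R',K')$ holds; (3) the set of values occurring in $K'$ is the same as the set of values occurring in $K$. -/

import Mathlib

/-! ### Entropy and conditional mutual information of random variables with finite domains -/

section Information

open MeasureTheory

variable {Ω : Type} [MeasurableSpace Ω]

/-- The probability `P(X = x)`. -/
noncomputable def probEq {α : Type} (μ : Measure Ω) (X : Ω → α) (x : α) : ℝ :=
  μ.real (X ⁻¹' {x})

/-- The pair `(X, Y)` of two random variables, as one random variable. -/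
def pairVar {α β : Type} (X : Ω → α) (Y : Ω → β) : Ω → α × β :=
  fun ω => (X ω, Y ω)

/-- The conditional entropy
`H(X | Y) = - ∑ x, y, P(X = x ∧ Y = y) log (P(X = x ∧ Y = y) / P(Y = y))`,
where the terms with `P(X = x ∧ Y = y) = 0` contribute `0`. (The base of the logarithm has no
influence on which mutual informations vanish.) -/
noncomputable def condEntropy {α β : Type} [Fintype α] [Fintype β] (μ : Measure Ω)
    (X : Ω → α) (Y : Ω → β) : ℝ :=
  - ∑ x : α, ∑ y : β, probEq μ (pairVar X Y) (x, y) *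
      Real.log (probEq μ (pairVar X Y) (x, y) / probEq μ Y y)

/-- The conditional mutual information `I(X; Y | Z) = H(X | Z) - H(X | Y, Z)`. -/
noncomputable def condMutualInfo {α β γ : Type} [Fintype α] [Fintype β] [Fintype γ]
    (μ : Measure Ω) (X : Ω → α) (Y : Ω → β) (Z : Ω → γ) : ℝ :=
  condEntropy μ X Z - condEntropy μ X (pairVar Y Z)

/-- The random variable `X_A = (X_j)_{j ∈ A}` formed from the variables `X_1, …, X_n`. -/
def subVar {n : ℕ} {S : Fin n → Type} (X : (j : Fin n) → Ω → S j) (A : Finset (Fin n)) :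
    Ω → ((j : {j // j ∈ A}) → S j) :=
  fun ω j => X j ω

end Information

/-! ### Conditional independence implications with cardinality bounds -/

/-- A triple `(A, B, C)` of subsets of an `n`-element index set, standing for the statement
`I(X_A; X_B | X_C) = 0`. -/
structure CITriple (n : ℕ) where
  A : Finset (Fin n)
  B : Finset (Fin n)
  C : Finset (Fin n)

/-- The statement `I(X_A; X_B | X_C) = 0`. -/
def CITriple.Holds {n : ℕ} (t : CITriple n) {Ω : Type} [MeasurableSpace Ω]
    (μ : MeasureTheory.Measure Ω) {S : Fin n → Type} [∀ j, Fintype (S j)]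
    (X : (j : Fin n) → Ω → S j) : Prop :=
  condMutualInfo μ (subVar X t.A) (subVar X t.B) (subVar X t.C) = 0

/-- The three sets of the triple are pairwise disjoint. -/
def CITriple.IsDisjoint {n : ℕ} (t : CITriple n) : Prop :=
  Disjoint t.A t.B ∧ Disjoint t.A t.C ∧ Disjoint t.B t.C

/-- A CI implication with cardinality bounds: `n` variables, a list of `m` triples (the
antecedents), one more triple (the consequent), and for each variable a bound in `ℕ ∪ {∞}`. -/
structure BoundedCI where
  n : ℕ
  antecedents : List (CITriple n)
  consequent : CITriple n
  bound : Fin n → ℕ∞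

/-- The list of all `m + 1` triples of the implication. -/
def BoundedCI.triples (R : BoundedCI) : List (CITriple R.n) :=
  R.antecedents ++ [R.consequent]

/-- The implication holds for all jointly distributed random variables `X_1, …, X_n` with finite
domains whose sizes respect the bounds; the bound `∞` leaves the size of the finite domain
unrestricted. -/
def BoundedCI.Valid (R : BoundedCI) : Prop :=
  ∀ (Ω : Type) [MeasurableSpace Ω] (μ : MeasureTheory.Measure Ω)
    [MeasureTheory.IsProbabilityMeasure μ]
    (S : Fin R.n → Type) [∀ j, Fintype (S j)] [∀ j, MeasurableSpace (S j)]
    [∀ j, MeasurableSingletonClass (S j)]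
    (X : (j : Fin R.n) → Ω → S j),
    (∀ j, Measurable (X j)) →
    (∀ j, (Fintype.card (S j) : ℕ∞) ≤ R.bound j) →
    (∀ t ∈ R.antecedents, t.Holds μ X) → R.consequent.Holds μ X

/-! ### Writing instances as strings over a finite alphabet -/

/-- The alphabet: two digits, a symbol for `∞` and a separator. -/
inductive CISym where
  | zero
  | one
  | infty
  | comma
  deriving DecidableEq

instance : Fintype CISym where
  elems := {CISym.zero, CISym.one, CISym.infty, CISym.comma}
  complete := by intro x; cases x <;> decide

/-- A bit as a symbol. -/
def CISym.ofBool (b : Bool) : CISym := if b then CISym.one else CISym.zero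

/-- A natural number in unary, followed by a separator. -/
def encodeUnary (k : ℕ) : List CISym :=
  List.replicate k CISym.one ++ [CISym.comma]

/-- A subset of an `n`-element set as its characteristic vector, a string of length `n`. -/
def encodeSubset {n : ℕ} (A : Finset (Fin n)) : List CISym :=
  List.ofFn fun j => CISym.ofBool (decide (j ∈ A))

/-- A triple of subsets, a string of length `3n`. -/
def encodeTriple {n : ℕ} (t : CITriple n) : List CISym :=
  encodeSubset t.A ++ encodeSubset t.B ++ encodeSubset t.C

/-- A cardinality bound: a natural number in binary, or the symbol for `∞`, followed by a
separator. -/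
def encodeBound (k : ℕ∞) : List CISym :=
  (if k = ⊤ then [CISym.infty] else (Computability.encodeNat k.toNat).map CISym.ofBool) ++
    [CISym.comma]

/-- The string of an instance: `n` and `m` in unary, the `m + 1` triples, the `n` bounds. -/
def BoundedCI.encode (R : BoundedCI) : List CISym :=
  encodeUnary R.n ++ encodeUnary R.antecedents.length ++
    R.triples.flatMap encodeTriple ++ (List.ofFn R.bound).flatMap encodeBound

/-! An instance is determined by its string. -/

theorem CISym.ofBool_injective : Function.Injective CISym.ofBool := by
  intro a b h
  cases a <;> cases b <;> simp_all [CISym.ofBool]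

theorem append_comma_cancel {u v s t : List CISym} (hu : CISym.comma ∉ u) (hv : CISym.comma ∉ v)
    (h : u ++ [CISym.comma] ++ s = v ++ [CISym.comma] ++ t) : u = v ∧ s = t := by
  induction u generalizing v with
  | nil =>
    cases v with
    | nil => simpa using h
    | cons b v =>
      have h' : CISym.comma = b := by
        simp only [List.cons_append, List.nil_append, List.cons.injEq] at h
        exact h.1
      exact absurd (by rw [h']; exact List.mem_cons_self) hv
  | cons a u ih =>
    cases v with
    | nil =>
      have h' : a = CISym.comma := by
        simp only [List.cons_append, List.nil_append, List.cons.injEq] at h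
        exact h.1
      exact absurd (by rw [h']; exact List.mem_cons_self) hu
    | cons b v =>
      simp only [List.mem_cons, not_or, List.cons_append, List.cons.injEq] at hu hv h
      obtain ⟨h1, h2⟩ := ih hu.2 hv.2 h.2
      exact ⟨by rw [h.1, h1], h2⟩

theorem encodeUnary_cancel {a b : ℕ} {s t : List CISym}
    (h : encodeUnary a ++ s = encodeUnary b ++ t) : a = b ∧ s = t := by
  obtain ⟨h1, h2⟩ := append_comma_cancel (by simp) (by simp) h
  exact ⟨by simpa using congrArg List.length h1, h2⟩

theorem encodeSubset_injective {n : ℕ} :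
    Function.Injective (encodeSubset : Finset (Fin n) → List CISym) := by
  intro A B h
  ext j
  have := CISym.ofBool_injective (congrFun (List.ofFn_injective h) j)
  simpa using this

theorem encodeTriple_injective {n : ℕ} :
    Function.Injective (encodeTriple : CITriple n → List CISym) := by
  rintro ⟨A, B, C⟩ ⟨A', B', C'⟩ h
  obtain ⟨h1, h2⟩ := List.append_inj h (by simp [encodeSubset])
  obtain ⟨h3, h4⟩ := List.append_inj h1 (by simp [encodeSubset])
  obtain rfl : A = A' := encodeSubset_injective h3
  obtain rfl : B = B' := encodeSubset_injective h4
  obtain rfl : C = C' := encodeSubset_injective h2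
  rfl

theorem encodeTriples_cancel {n : ℕ} {u v : List (CITriple n)} {s t : List CISym}
    (hl : u.length = v.length)
    (h : u.flatMap encodeTriple ++ s = v.flatMap encodeTriple ++ t) : u = v ∧ s = t := by
  induction u generalizing v with
  | nil =>
    cases v with
    | nil => simpa using h
    | cons b v => simp at hl
  | cons a u ih =>
    cases v with
    | nil => simp at hl
    | cons b v =>
      simp only [List.flatMap_cons, List.append_assoc] at h
      obtain ⟨h1, h2⟩ := List.append_inj h (by simp [encodeTriple, encodeSubset])
      obtain ⟨h3, h4⟩ := ih (by simpa using hl) h2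
      exact ⟨by rw [encodeTriple_injective h1, h3], h4⟩

theorem encodeBound_cancel {a b : ℕ∞} {s t : List CISym}
    (h : encodeBound a ++ s = encodeBound b ++ t) : a = b ∧ s = t := by
  have hb : ∀ l : List Bool, CISym.comma ∉ l.map CISym.ofBool := by
    intro l hl
    obtain ⟨c, -, hc⟩ := List.mem_map.1 hl
    cases c <;> simp [CISym.ofBool] at hc
  have hi : ∀ l : List Bool, [CISym.infty] ≠ l.map CISym.ofBool := by
    intro l hl
    have : CISym.infty ∈ l.map CISym.ofBool := by simp [← hl]
    obtain ⟨c, -, hc⟩ := List.mem_map.1 this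
    cases c <;> simp [CISym.ofBool] at hc
  have hc : ∀ k : ℕ∞, CISym.comma ∉ (if k = ⊤ then [CISym.infty] else
      (Computability.encodeNat k.toNat).map CISym.ofBool) := by
    intro k
    split_ifs
    · simp
    · exact hb _
  obtain ⟨h1, h2⟩ := append_comma_cancel (hc a) (hc b) h
  refine ⟨?_, h2⟩
  split_ifs at h1 with ha hb' hb'
  · rw [ha, hb']
  · exact absurd h1 (hi _)
  · exact absurd h1.symm (hi _)
  · have h3 := congrArg Computability.decodeNat
      (List.map_injective_iff.2 CISym.ofBool_injective h1)
    simp only [Computability.decode_encodeNat] at h3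
    rw [← ENat.natCast_toNat_eq_self.2 ha, ← ENat.natCast_toNat_eq_self.2 hb', h3]

theorem encodeBounds_injective {u v : List ℕ∞} (hl : u.length = v.length)
    (h : u.flatMap encodeBound = v.flatMap encodeBound) : u = v := by
  induction u generalizing v with
  | nil => exact (List.length_eq_zero_iff.1 (by simpa using hl.symm)).symm
  | cons a u ih =>
    cases v with
    | nil => simp at hl
    | cons b v =>
      simp only [List.flatMap_cons] at h
      obtain ⟨h1, h2⟩ := encodeBound_cancel h
      rw [h1, ih (by simpa using hl) h2]

theorem BoundedCI.encode_injective : Function.Injective BoundedCI.encode := by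
  rintro ⟨n, u, c, K⟩ ⟨n', u', c', K'⟩ h
  simp only [BoundedCI.encode, BoundedCI.triples, List.append_assoc] at h
  obtain ⟨rfl, h⟩ := encodeUnary_cancel h
  obtain ⟨hm, h⟩ := encodeUnary_cancel h
  obtain ⟨h1, h2⟩ := encodeTriples_cancel (by simp [hm]) h
  obtain ⟨h3, h4⟩ := List.append_inj h1 hm
  have h5 := List.ofFn_injective (encodeBounds_injective (by simp) h2)
  simp only [List.cons.injEq, and_true] at h4
  rw [h3, h4, h5]

/-!
Every variable `X_j` is replaced by three copies, with the same bound, and a statement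
`I(X_A; X_B | X_C) = 0` about the original variables is placed on the copies `0`, `1`, `2`, so that
its three sets become disjoint (`CITriple.spread`). Literal equality of the copies cannot be
expressed by statements with disjoint sets, but the following weaker property can, and suffices: for
suitable pairs `k ≠ l`, the `k`-th copy of `X_j` is independent of all other copies of all variables
given the `l`-th copy of `X_j` (`markovTriple`). These statements are added to the antecedents.

If the new implication is valid, so is the old one, because three equal copies of a model are a model
of the added statements (`BoundedCI.valid_of_valid_triplicate`).

Conversely, let copies be given that satisfy the added statements. Any two copies of `X_j` are
independent given the third one. By the double Markov property, the three copies then have a common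
part `V_j`: a function of the copy with index `0`, almost surely determined by each of the other
copies, such that the copies `0` and `2` are independent given `V_j`
(`IsDoubleMarkov.condIndepVar_commonRep`). Its values are chosen among those of the copy `0`, so
that it respects the bound. Each copy of `X_j` is then `V_j` with some noise that is independent of
everything else, and so `I(X_A; X_B | X_C) = 0` for the copies `0`, `1`, `2` is equivalent to
`I(V_A; V_B | V_C) = 0`, also when `A`, `B`, `C` overlap (`IsNoisyCopy.condIndepFor_iff`). Hence the
`V_j` form a model of the old implication (`BoundedCI.Valid.holds_spread`). The equivalence is
derived from the submodularity of entropy alone; the translation between mutual information and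
probabilities is `condMutualInfo_eq_zero_iff`.

For the running time, the reduction is carried out on strings by a machine with ten stacks
(`Triplicate.program`). With the index `3 j + k` for the `k`-th copy of `X_j`, each bit of a
characteristic vector turns into three bits in place, and the added triples are made of a unary
counter for `j`. The simulation `Triplicate.program_reachesIn` shows that the number of steps is at
most quadratic in the length of the input.
-/

/-! ### Conditional independence for submodular set functions -/

section Polymatroid

variable {ι : Type} [DecidableEq ι]

/-- Submodularity of a set function, in the form used for entropies. -/
def IsSubmodular (h : Finset ι → ℝ) : Prop :=
  ∀ A B C, h (A ∪ B ∪ C) + h C ≤ h (A ∪ C) + h (B ∪ C)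

/-- Conditional independence of `A` and `B` given `C` with respect to a set function. The sets may
overlap; in particular `CondIndepFor h A A C` says that `C` determines `A`. -/
def CondIndepFor (h : Finset ι → ℝ) (A B C : Finset ι) : Prop :=
  h (A ∪ C) + h (B ∪ C) = h (A ∪ B ∪ C) + h C

namespace CondIndepFor

variable {h : Finset ι → ℝ} {A A' B B' C D : Finset ι}

theorem symm (H : CondIndepFor h A B C) : CondIndepFor h B A C := by
  unfold CondIndepFor at *
  rw [Finset.union_comm B A]
  linarith

theorem decomp (hs : IsSubmodular h) (H : CondIndepFor h A (B ∪ D) C) : CondIndepFor h A B C := by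
  unfold CondIndepFor at *
  have h1 := hs A B C
  have h2 := hs A D (B ∪ C)
  have e1 : A ∪ D ∪ (B ∪ C) = A ∪ (B ∪ D) ∪ C := by grind
  have e2 : A ∪ (B ∪ C) = A ∪ B ∪ C := by grind
  have e3 : D ∪ (B ∪ C) = B ∪ D ∪ C := by grind
  rw [e1, e2, e3] at h2
  linarith

theorem mono_right (hs : IsSubmodular h) (H : CondIndepFor h A B C) (hB : B' ⊆ B) :
    CondIndepFor h A B' C := by
  rw [← Finset.union_sdiff_of_subset hB] at H
  exact H.decomp hs

theorem mono_left (hs : IsSubmodular h) (H : CondIndepFor h A B C) (hA : A' ⊆ A) :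
    CondIndepFor h A' B C :=
  (H.symm.mono_right hs hA).symm

theorem weak_union (hs : IsSubmodular h) (H : CondIndepFor h A (B ∪ D) C) :
    CondIndepFor h A B (D ∪ C) := by
  have h1 : CondIndepFor h A D C := H.mono_right hs Finset.subset_union_right
  unfold CondIndepFor at *
  have e1 : A ∪ (D ∪ C) = A ∪ D ∪ C := by grind
  have e2 : B ∪ (D ∪ C) = B ∪ D ∪ C := by grind
  have e3 : A ∪ B ∪ (D ∪ C) = A ∪ (B ∪ D) ∪ C := by grind
  rw [e1, e2, e3]
  linarith

theorem contraction (H : CondIndepFor h A B (D ∪ C)) (H' : CondIndepFor h A D C) :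
    CondIndepFor h A (B ∪ D) C := by
  unfold CondIndepFor at *
  have e1 : A ∪ (D ∪ C) = A ∪ D ∪ C := by grind
  have e2 : B ∪ (D ∪ C) = B ∪ D ∪ C := by grind
  have e3 : A ∪ B ∪ (D ∪ C) = A ∪ (B ∪ D) ∪ C := by grind
  rw [e1, e2, e3] at H
  linarith

theorem of_empty_left (h : Finset ι → ℝ) (B C : Finset ι) : CondIndepFor h ∅ B C := by
  simp [CondIndepFor, add_comm]

end CondIndepFor

/-- `C` determines `D`: adjoining `D` to a set containing `C` does not change the entropy. -/
def Determines (h : Finset ι → ℝ) (C D : Finset ι) : Prop :=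
  ∀ E, C ⊆ E → h (E ∪ D) = h E

namespace Determines

variable {h : Finset ι → ℝ} {A B C D E : Finset ι}

/-- A set that is independent of itself given `C` is determined by `C`. -/
theorem of_condIndepFor (hs : IsSubmodular h) (H : CondIndepFor h D D C) : Determines h C D := by
  intro E hE
  unfold CondIndepFor at H
  have h1 := hs D E C
  have h2 := hs D D E
  rw [Finset.union_self] at H h2
  have e1 : D ∪ E ∪ C = E ∪ D := by grind
  have e2 : E ∪ C = E := by grind
  have e3 : D ∪ E = E ∪ D := by grind
  rw [e1, e2] at h1
  rw [e3] at h2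
  linarith

theorem mono (H : Determines h C D) (hC : C ⊆ E) : Determines h E D :=
  fun F hF => H F (hC.trans hF)

theorem empty (h : Finset ι → ℝ) (C : Finset ι) : Determines h C ∅ :=
  fun E _ => by rw [Finset.union_empty]

theorem union (H : Determines h C D) (H' : Determines h C E) : Determines h C (D ∪ E) := by
  intro F hF
  rw [← Finset.union_assoc, H' _ (hF.trans Finset.subset_union_left), H F hF]

/-- A set determined by `C` may be adjoined to the condition `C`. -/
theorem condIndepFor_cond (hD : Determines h C D) :
    CondIndepFor h A B (D ∪ C) ↔ CondIndepFor h A B C := by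
  unfold CondIndepFor
  have e1 : A ∪ (D ∪ C) = A ∪ C ∪ D := by grind
  have e2 : B ∪ (D ∪ C) = B ∪ C ∪ D := by grind
  have e3 : A ∪ B ∪ (D ∪ C) = A ∪ B ∪ C ∪ D := by grind
  rw [e1, e2, e3, Finset.union_comm D C, hD _ Finset.subset_union_right,
    hD _ Finset.subset_union_right, hD _ Finset.subset_union_right, hD _ subset_rfl]

/-- A set determined by `B` may be adjoined to `B`. -/
theorem condIndepFor_right (hD : Determines h B D) (H : CondIndepFor h A B C) :
    CondIndepFor h A (B ∪ D) C := by
  unfold CondIndepFor at *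
  have e2 : B ∪ D ∪ C = B ∪ C ∪ D := by grind
  have e3 : A ∪ (B ∪ D) ∪ C = A ∪ B ∪ C ∪ D := by grind
  rw [e2, e3, hD _ Finset.subset_union_left,
    hD _ (Finset.subset_union_right.trans Finset.subset_union_left)]
  exact H

theorem condIndepFor_left (hD : Determines h A D) (H : CondIndepFor h A B C) :
    CondIndepFor h (A ∪ D) B C :=
  (hD.condIndepFor_right H.symm).symm

end Determines

/-! ### Three noisy copies of a family of variables -/

variable {α : Type} [DecidableEq α]

/-- The indices of the `k`-th copies of the variables in `A`; the copy `none` is the common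
part. -/
def copyOf (k : Option (Fin 3)) (A : Finset α) : Finset (α × Option (Fin 3)) :=
  A.image fun j => (j, k)

theorem mem_copyOf {k : Option (Fin 3)} {A : Finset α} {x : α × Option (Fin 3)} :
    x ∈ copyOf k A ↔ x.1 ∈ A ∧ x.2 = k := by
  obtain ⟨a, l⟩ := x
  simp [copyOf, eq_comm]

variable [Fintype α]

/-- The indices of all noisy copies. -/
def allCopies (α : Type) [DecidableEq α] [Fintype α] : Finset (α × Option (Fin 3)) :=
  Finset.univ.filter fun x => x.2 ≠ none

theorem mem_allCopies {x : α × Option (Fin 3)} : x ∈ allCopies α ↔ x.2 ≠ none := by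
  simp [allCopies]

/-- The pairs `(k, l)` such that the `k`-th copy of a variable is required to be independent of
all other copies of all variables given the `l`-th copy. -/
def copyPair : Fin 4 → Fin 3 × Fin 3 := ![(0, 2), (0, 1), (1, 0), (2, 0)]

/-- What is known about the entropies of three noisy copies of a family of variables together
with the common parts of the copies. -/
structure IsNoisyCopy (h : Finset (α × Option (Fin 3)) → ℝ) : Prop where
  submodular : IsSubmodular h
  markov : ∀ j p, CondIndepFor h {(j, some (copyPair p).1)}
    (allCopies α \ {(j, some (copyPair p).1), (j, some (copyPair p).2)})
    {(j, some (copyPair p).2)}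
  determines : ∀ j k, Determines h {(j, some k)} {(j, none)}
  common : ∀ j, CondIndepFor h {(j, some 0)} {(j, some 2)} {(j, none)}

namespace IsNoisyCopy

variable {h : Finset (α × Option (Fin 3)) → ℝ}

/-- If `k` is independent of the other copies given `l`, and of `l` given the common part, then
`k` is independent of everything else given the common part. -/
theorem condIndepFor_single_of_pair (H : IsNoisyCopy h) (j : α) (p : Fin 4)
    (hp : CondIndepFor h {(j, some (copyPair p).1)} {(j, some (copyPair p).2)} {(j, none)}) :
    CondIndepFor h {(j, some (copyPair p).1)} (allCopies α \ {(j, some (copyPair p).1)})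
      {(j, none)} := by
  have h1 := (H.determines j (copyPair p).2).condIndepFor_cond.2 (H.markov j p)
  rw [Finset.union_comm] at h1
  refine (h1.contraction hp).mono_right H.submodular ?_
  intro x
  simp only [Finset.mem_sdiff, Finset.mem_singleton, Finset.mem_union, Finset.mem_insert]
  tauto

/-- Each copy of a variable is independent of all other copies of all variables given the common
part. For the copy `0` this rests on its independence of the copy `2`; the other copies follow by
using the copy `0`. -/
theorem condIndepFor_single (H : IsNoisyCopy h) (j : α) (k : Fin 3) :
    CondIndepFor h {(j, some k)} (allCopies α \ {(j, some k)}) {(j, none)} := by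
  have h0 : CondIndepFor h {(j, some 0)} (allCopies α \ {(j, some 0)}) {(j, none)} :=
    H.condIndepFor_single_of_pair j 0 (H.common j)
  have h1 : ∀ k : Fin 3, k ≠ 0 → CondIndepFor h {(j, some k)} {(j, some 0)} {(j, none)} := by
    intro k hk
    refine (h0.mono_right H.submodular ?_).symm
    simp [mem_allCopies, hk]
  fin_cases k
  · exact h0
  · exact H.condIndepFor_single_of_pair j 2 (h1 1 (by decide))
  · exact H.condIndepFor_single_of_pair j 3 (h1 2 (by decide))

/-- The copies determine the common parts. -/
theorem determines_copyOf (H : IsNoisyCopy h) (k : Fin 3) (A : Finset α) :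
    Determines h (copyOf (some k) A) (copyOf none A) := by
  induction A using Finset.induction_on with
  | empty => exact Determines.empty _ _
  | insert j A _ ih =>
    have e : copyOf none (insert j A) = {(j, none)} ∪ copyOf none A := by
      ext x; simp [mem_copyOf, Prod.ext_iff]; tauto
    rw [e]
    refine ((H.determines j k).mono ?_).union (ih.mono ?_)
    · simp [mem_copyOf]
    · intro x; simp only [mem_copyOf, Finset.mem_insert]; tauto

/-- The `k`-th copies of the variables in `A` are independent of all other copies given the common
parts. -/
theorem condIndepFor_copyOf (H : IsNoisyCopy h) (k : Fin 3) (A : Finset α) :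
    CondIndepFor h (copyOf (some k) A) (allCopies α \ copyOf (some k) A) (copyOf none A) := by
  have hs := H.submodular
  induction A using Finset.induction_on with
  | empty => exact CondIndepFor.of_empty_left _ _ _
  | insert j A hj ih =>
    set a := copyOf (some k) A
    set va := copyOf none A
    set R := allCopies α \ copyOf (some k) (insert j A) with hR
    have ea : copyOf (some k) (insert j A) = a ∪ {(j, some k)} := by
      ext x; simp [a, mem_copyOf, Prod.ext_iff]; tauto
    have eva : copyOf none (insert j A) = va ∪ {(j, none)} := by
      ext x; simp [va, mem_copyOf, Prod.ext_iff]; tauto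
    have hk : ∃ l : Fin 3, l ≠ k := ⟨k + 1, by fin_cases k <;> decide⟩
    obtain ⟨l, hl⟩ := hk
    have hRv : Determines h R {(j, none)} := by
      refine (H.determines j l).mono ?_
      simp [hR, mem_copyOf, mem_allCopies, hl]
    -- the new variable is independent of the rest given everything on the left
    have s1 : CondIndepFor h {(j, some k)} R (va ∪ (a ∪ {(j, none)})) := by
      have h1 : CondIndepFor h {(j, some k)} (R ∪ a) {(j, none)} := by
        refine (H.condIndepFor_single j k).mono_right hs ?_
        intro x
        simp only [hR, a, Finset.mem_union, Finset.mem_sdiff, mem_copyOf, mem_allCopies,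
          Finset.mem_singleton, Finset.mem_insert, Prod.ext_iff]
        grind
      refine (Determines.condIndepFor_cond ?_).2 (h1.weak_union hs)
      exact (H.determines_copyOf k A).mono Finset.subset_union_left
    -- the old variables are independent of the rest given the common parts
    have s2 : CondIndepFor h a R ({(j, none)} ∪ va) := by
      have h1 : CondIndepFor h a R va := by
        refine ih.mono_right hs ?_
        rw [hR, ea]
        exact Finset.sdiff_subset_sdiff subset_rfl Finset.subset_union_left
      exact (hRv.condIndepFor_right h1).weak_union hs
    have s3 : CondIndepFor h R ({(j, some k)} ∪ a) ({(j, none)} ∪ va) := by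
      refine CondIndepFor.contraction ?_ s2.symm
      have e : a ∪ ({(j, none)} ∪ va) = va ∪ (a ∪ {(j, none)}) := by grind
      rw [e]
      exact s1.symm
    rw [ea, eva, Finset.union_comm a, Finset.union_comm va]
    exact s3.symm

/-- Independence of distinct copies is the same as independence of the common parts. -/
theorem condIndepFor_iff (H : IsNoisyCopy h) (A B C : Finset α) :
    CondIndepFor h (copyOf (some 0) A) (copyOf (some 1) B) (copyOf (some 2) C) ↔
      CondIndepFor h (copyOf none A) (copyOf none B) (copyOf none C) := by
  have hs := H.submodular
  have dA := H.determines_copyOf 0 A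
  have dB := H.determines_copyOf 1 B
  have dC := H.determines_copyOf 2 C
  have iA := H.condIndepFor_copyOf 0 A
  have iB := H.condIndepFor_copyOf 1 B
  have iC := H.condIndepFor_copyOf 2 C
  set a := copyOf (some 0) A
  set b := copyOf (some 1) B
  set c := copyOf (some 2) C
  set va := copyOf none A
  set vb := copyOf none B
  set vc := copyOf none C
  have sub : ∀ (k l m : Fin 3) (P Q T : Finset α), l ≠ k → m ≠ k →
      copyOf (some l) Q ∪ copyOf (some m) T ⊆ allCopies α \ copyOf (some k) P := by
    intro k l m P Q T hl hm x
    simp only [Finset.mem_union, Finset.mem_sdiff, mem_copyOf, mem_allCopies]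
    grind
  have iC' : CondIndepFor h c (va ∪ vb) vc := by
    have h1 := iC.mono_right hs (sub 2 0 1 C A B (by decide) (by decide))
    refine (Determines.condIndepFor_right ((dA.mono Finset.subset_union_left).union
      (dB.mono Finset.subset_union_right)) h1).mono_right hs Finset.subset_union_right
  have iA' : CondIndepFor h a (c ∪ vb) va := by
    have h1 := iA.mono_right hs (sub 0 2 1 A C B (by decide) (by decide))
    refine (Determines.condIndepFor_right (dB.mono Finset.subset_union_right) h1).mono_right hs ?_
    exact Finset.union_subset_union Finset.subset_union_left subset_rfl
  have iB' : CondIndepFor h b (c ∪ a) vb :=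
    iB.mono_right hs (sub 1 2 0 B C A (by decide) (by decide))
  constructor
  · -- pass to the common parts of `a` and `b`, then exchange `c` for its common part
    intro h1
    have h2 : CondIndepFor h va vb c :=
      ((dB.condIndepFor_right (dA.condIndepFor_left h1)).mono_right hs
        Finset.subset_union_right).mono_left hs Finset.subset_union_right
    have h3 : CondIndepFor h va vb (c ∪ vc) := by
      rw [Finset.union_comm]
      exact dC.condIndepFor_cond.2 h2
    exact (h3.contraction (iC'.mono_right hs Finset.subset_union_left).symm).mono_right hs
      Finset.subset_union_left
  · -- exchange the common part of `c` for `c`, then those of `a` and `b` one after the other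
    intro h1
    have h2 : CondIndepFor h va (c ∪ vb) vc := (iC'.weak_union hs).symm.contraction h1
    have h3 : CondIndepFor h va vb c := by
      rw [Finset.union_comm] at h2
      have := h2.weak_union hs
      rw [Finset.union_comm] at this
      exact dC.condIndepFor_cond.1 this
    have h4 : CondIndepFor h a vb c := by
      rw [Finset.union_comm] at iA'
      have h5 := iA'.weak_union hs
      rw [Finset.union_comm] at h5
      exact (h5.symm.contraction h3.symm).symm.mono_left hs Finset.subset_union_left
    rw [Finset.union_comm] at iB'
    have h5 := iB'.weak_union hs
    rw [Finset.union_comm] at h5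
    exact (h5.symm.contraction h4).mono_right hs Finset.subset_union_left

end IsNoisyCopy

end Polymatroid

/-! ### Entropy and conditional independence of random variables -/

section Entropy

open MeasureTheory

variable {Ω : Type} [MeasurableSpace Ω] {α β γ : Type}

/-- All events expressible through the random variable are measurable. -/
def IsDiscreteVar (X : Ω → α) : Prop :=
  ∀ s : Set α, MeasurableSet (X ⁻¹' s)

namespace IsDiscreteVar

theorem of_measurable [Finite α] [MeasurableSpace α] [MeasurableSingletonClass α] {X : Ω → α}
    (hX : Measurable X) : IsDiscreteVar X :=
  fun s => hX s.toFinite.measurableSet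

theorem comp {X : Ω → α} (hX : IsDiscreteVar X) (f : α → β) :
    IsDiscreteVar fun ω => f (X ω) :=
  fun s => hX (f ⁻¹' s)

theorem of_singleton [Finite α] {X : Ω → α} (hX : ∀ x, MeasurableSet (X ⁻¹' {x})) :
    IsDiscreteVar X := by
  intro s
  rw [← Set.biUnion_preimage_singleton]
  exact s.toFinite.measurableSet_biUnion fun x _ => hX x

theorem pairVar [Finite α] [Finite β] {X : Ω → α} {Y : Ω → β} (hX : IsDiscreteVar X)
    (hY : IsDiscreteVar Y) : IsDiscreteVar (pairVar X Y) := by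
  refine of_singleton ?_
  rintro ⟨x, y⟩
  have e : _root_.pairVar X Y ⁻¹' {(x, y)} = X ⁻¹' {x} ∩ Y ⁻¹' {y} := by
    ext ω; simp [_root_.pairVar]
  rw [e]
  exact (hX _).inter (hY _)

theorem pi {ι : Type} [Finite ι] {T : ι → Type} [∀ i, Finite (T i)] {F : (i : ι) → Ω → T i}
    (hF : ∀ i, IsDiscreteVar (F i)) : IsDiscreteVar fun ω i => F i ω := by
  refine of_singleton fun x => ?_
  have e : (fun ω i => F i ω) ⁻¹' {x} = ⋂ i, F i ⁻¹' {x i} := by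
    ext ω; simp [funext_iff]
  rw [e]
  exact MeasurableSet.iInter fun i => hF i _

end IsDiscreteVar

variable {μ : Measure Ω} {X : Ω → α} {Y : Ω → β} {Z : Ω → γ}

theorem probEq_nonneg (x : α) : 0 ≤ probEq μ X x :=
  measureReal_nonneg

theorem probEq_swap (x : α) (y : β) :
    probEq μ (pairVar Y X) (y, x) = probEq μ (pairVar X Y) (x, y) := by
  unfold probEq
  congr 1
  ext ω
  simp [pairVar, and_comm]

variable [IsProbabilityMeasure μ]

theorem probEq_eq_sum_left [Fintype α] (hX : IsDiscreteVar X) (hY : IsDiscreteVar Y) (y : β) :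
    probEq μ Y y = ∑ x, probEq μ (pairVar X Y) (x, y) := by
  unfold probEq
  have e : Y ⁻¹' {y} = ⋃ x ∈ (Finset.univ : Finset α), pairVar X Y ⁻¹' {(x, y)} := by
    ext ω; simp [pairVar]
  rw [e, measureReal_biUnion_finset]
  · intro x _ x' _ hne
    refine Set.disjoint_left.2 fun ω h1 h2 => hne ?_
    simp only [pairVar, Set.mem_preimage, Set.mem_singleton_iff, Prod.mk.injEq] at h1 h2
    rw [← h1.1, ← h2.1]
  · intro x _
    have e : pairVar X Y ⁻¹' {(x, y)} = X ⁻¹' {x} ∩ Y ⁻¹' {y} := by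
      ext ω; simp [pairVar]
    rw [e]
    exact (hX _).inter (hY _)

theorem probEq_eq_sum_right [Fintype β] (hX : IsDiscreteVar X) (hY : IsDiscreteVar Y) (x : α) :
    probEq μ X x = ∑ y, probEq μ (pairVar X Y) (x, y) := by
  rw [probEq_eq_sum_left hY hX]
  exact Finset.sum_congr rfl fun y _ => probEq_swap x y

theorem sum_probEq [Fintype α] (hX : IsDiscreteVar X) : ∑ x, probEq μ X x = 1 := by
  have h := probEq_eq_sum_left (μ := μ) hX (Y := fun _ => ()) (fun s => MeasurableSet.const _) ()
  have e : probEq μ (fun _ : Ω => ()) () = 1 := by simp [probEq]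
  rw [e] at h
  rw [h]
  refine Finset.sum_congr rfl fun x _ => ?_
  unfold probEq
  congr 1
  ext ω
  simp [pairVar]

theorem probEq_pair_le_right (x : α) (y : β) : probEq μ (pairVar X Y) (x, y) ≤ probEq μ Y y := by
  refine measureReal_mono ?_
  intro ω
  simp +contextual [pairVar]

theorem probEq_triple_le (x : α) (y : β) (z : γ) :
    probEq μ (pairVar X (pairVar Y Z)) (x, (y, z)) ≤ probEq μ (pairVar X Z) (x, z) := by
  refine measureReal_mono ?_
  intro ω
  simp +contextual [pairVar]

omit [IsProbabilityMeasure μ] in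
theorem probEq_triple_swap (x : α) (y : β) (z : γ) :
    probEq μ (pairVar Y (pairVar X Z)) (y, (x, z)) =
      probEq μ (pairVar X (pairVar Y Z)) (x, (y, z)) := by
  unfold probEq
  congr 1
  ext ω
  simp [pairVar]
  tauto

theorem probEq_pair_eq_sum_middle [Fintype β] (hX : IsDiscreteVar X) (hY : IsDiscreteVar Y)
    (hZ : IsDiscreteVar Z) [Finite α] [Finite γ] (x : α) (z : γ) :
    probEq μ (pairVar X Z) (x, z) = ∑ y, probEq μ (pairVar X (pairVar Y Z)) (x, (y, z)) := by
  rw [probEq_eq_sum_left hY (hX.pairVar hZ)]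
  exact Finset.sum_congr rfl fun y _ => probEq_triple_swap x y z

/-- The Shannon entropy of a random variable. -/
noncomputable def varEntropy [Fintype α] (μ : Measure Ω) (X : Ω → α) : ℝ :=
  ∑ x, Real.negMulLog (probEq μ X x)

omit [IsProbabilityMeasure μ] in
/-- Random variables that generate the same partition have the same entropy. -/
theorem varEntropy_congr [Fintype α] [Fintype β]
    (hXY : ∀ ω ω', X ω = X ω' ↔ Y ω = Y ω') : varEntropy μ X = varEntropy μ Y := by
  have hne : ∀ x, Real.negMulLog (probEq μ X x) ≠ 0 → ∃ ω, X ω = x := by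
    intro x hx
    by_contra! h
    have e : X ⁻¹' {x} = ∅ := by ext ω; simp [h]
    simp [probEq, e] at hx
  have hne' : ∀ y, Real.negMulLog (probEq μ Y y) ≠ 0 → ∃ ω, Y ω = y := by
    intro x hx
    by_contra! h
    have e : Y ⁻¹' {x} = ∅ := by ext ω; simp [h]
    simp [probEq, e] at hx
  have key : ∀ ω, probEq μ X (X ω) = probEq μ Y (Y ω) := by
    intro ω
    unfold probEq
    congr 1
    ext ω'
    simp [hXY]
  unfold varEntropy
  refine Finset.sum_bij_ne_zero (fun x _ hx => Y (hne x hx).choose) (fun _ _ _ => Finset.mem_univ _)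
    ?_ ?_ ?_
  · intro x _ hx x' _ hx' h
    rw [← (hne x hx).choose_spec, ← (hne x' hx').choose_spec]
    exact (hXY _ _).2 h
  · intro y _ hy
    obtain ⟨ω, rfl⟩ := hne' y hy
    rw [← key] at hy
    exact ⟨X ω, Finset.mem_univ _, hy, (hXY _ _).1 (hne _ hy).choose_spec⟩
  · intro x _ hx
    conv_lhs => rw [← (hne x hx).choose_spec]
    rw [key]

theorem condEntropy_eq [Fintype α] [Fintype β] (hX : IsDiscreteVar X) (hY : IsDiscreteVar Y) :
    condEntropy μ X Y = varEntropy μ (pairVar X Y) - varEntropy μ Y := by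
  unfold condEntropy varEntropy
  have h1 : ∀ x y, probEq μ (pairVar X Y) (x, y) *
      Real.log (probEq μ (pairVar X Y) (x, y) / probEq μ Y y) =
      - Real.negMulLog (probEq μ (pairVar X Y) (x, y)) -
        probEq μ (pairVar X Y) (x, y) * Real.log (probEq μ Y y) := by
    intro x y
    rcases eq_or_ne (probEq μ (pairVar X Y) (x, y)) 0 with h0 | h0
    · simp [h0]
    · have hy : probEq μ Y y ≠ 0 := by
        have h2 := probEq_pair_le_right (μ := μ) (X := X) (Y := Y) x y
        have h3 := probEq_nonneg (μ := μ) (X := pairVar X Y) (x, y)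
        have h4 : 0 < probEq μ (pairVar X Y) (x, y) := lt_of_le_of_ne h3 h0.symm
        linarith
      rw [Real.log_div h0 hy, Real.negMulLog]
      ring
  simp only [h1, Finset.sum_sub_distrib, Finset.sum_neg_distrib, Fintype.sum_prod_type]
  have h2 : ∑ x, ∑ y, probEq μ (pairVar X Y) (x, y) * Real.log (probEq μ Y y) =
      - ∑ y, Real.negMulLog (probEq μ Y y) := by
    rw [Finset.sum_comm, ← Finset.sum_neg_distrib]
    refine Finset.sum_congr rfl fun y _ => ?_
    rw [← Finset.sum_mul, ← probEq_eq_sum_left hX hY, Real.negMulLog]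
    ring
  rw [h2]
  ring

/-- `X` and `Y` are conditionally independent given `Z`, as a statement on probabilities. -/
def CondIndepVar (μ : Measure Ω) (X : Ω → α) (Y : Ω → β) (Z : Ω → γ) : Prop :=
  ∀ x y z, probEq μ (pairVar X (pairVar Y Z)) (x, (y, z)) * probEq μ Z z =
    probEq μ (pairVar X Z) (x, z) * probEq μ (pairVar Y Z) (y, z)

/-- The excess of `p log (p c / (a b))` over its linearization at `p c = a b` is nonnegative and
vanishes only there. -/
theorem mul_log_add_sub_nonneg {p a b c : ℝ} (hp : 0 ≤ p) (ha : p ≤ a) (hb : p ≤ b) (hc : a ≤ c) :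
    0 ≤ p * (Real.log p + Real.log c - Real.log a - Real.log b) + (a * b / c - p) ∧
    (p * (Real.log p + Real.log c - Real.log a - Real.log b) + (a * b / c - p) = 0 ↔
      p * c = a * b) := by
  rcases hp.eq_or_lt with rfl | hp
  · constructor
    · have h0 : 0 ≤ c := ha.trans hc
      have : 0 ≤ a * b / c := by positivity
      simpa
    · simp only [zero_mul, sub_zero, zero_add, div_eq_zero_iff, mul_eq_zero,
        zero_eq_mul]
      constructor
      · rintro (h | rfl)
        · exact h
        · exact Or.inl (le_antisymm hc ha)
      · exact Or.inl
  · have ha' : 0 < a := hp.trans_le ha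
    have hb' : 0 < b := hp.trans_le hb
    have hc' : 0 < c := ha'.trans_le hc
    set t := a * b / (c * p) with ht
    have htp : 0 < t := by positivity
    have e1 : a * b / c = p * t := by rw [ht]; field_simp
    have e2 : Real.log p + Real.log c - Real.log a - Real.log b = - Real.log t := by
      rw [ht, Real.log_div (by positivity) (by positivity), Real.log_mul ha'.ne' hb'.ne',
        Real.log_mul hc'.ne' hp.ne']
      ring
    have e3 : p * c = a * b ↔ t = 1 := by
      rw [ht, div_eq_one_iff_eq (by positivity), mul_comm p, eq_comm]
    rw [e1, e2, e3]
    have e4 : p * -Real.log t + (p * t - p) = p * (t - 1 - Real.log t) := by ring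
    rw [e4]
    constructor
    · exact mul_nonneg hp.le (by linarith [Real.log_le_sub_one_of_pos htp])
    · constructor
      · intro h
        by_contra hne
        have := Real.log_lt_sub_one_of_pos htp hne
        rcases mul_eq_zero.1 h with h | h <;> linarith
      · rintro h
        simp [h]

section Information

variable [Fintype α] [Fintype β] [Fintype γ]

theorem condMutualInfo_eq_varEntropy (hX : IsDiscreteVar X) (hY : IsDiscreteVar Y)
    (hZ : IsDiscreteVar Z) :
    condMutualInfo μ X Y Z = varEntropy μ (pairVar X Z) + varEntropy μ (pairVar Y Z) -
      varEntropy μ (pairVar X (pairVar Y Z)) - varEntropy μ Z := by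
  rw [condMutualInfo, condEntropy_eq hX hZ, condEntropy_eq hX (hY.pairVar hZ)]
  ring

/-- The mutual information as a sum of nonnegative terms. The linear correction in each term does
not change the sum, as both `P(x, z) P(y, z) / P(z)` and `P(x, y, z)` add up to `1`. -/
theorem condMutualInfo_eq_sum (hX : IsDiscreteVar X) (hY : IsDiscreteVar Y)
    (hZ : IsDiscreteVar Z) :
    condMutualInfo μ X Y Z = ∑ x, ∑ y, ∑ z,
      (probEq μ (pairVar X (pairVar Y Z)) (x, (y, z)) *
        (Real.log (probEq μ (pairVar X (pairVar Y Z)) (x, (y, z))) + Real.log (probEq μ Z z) -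
          Real.log (probEq μ (pairVar X Z) (x, z)) - Real.log (probEq μ (pairVar Y Z) (y, z))) +
        (probEq μ (pairVar X Z) (x, z) * probEq μ (pairVar Y Z) (y, z) / probEq μ Z z -
          probEq μ (pairVar X (pairVar Y Z)) (x, (y, z)))) := by
  rw [condMutualInfo_eq_varEntropy hX hY hZ]
  have sXZ : ∀ x z, ∑ y, probEq μ (pairVar X (pairVar Y Z)) (x, (y, z)) =
      probEq μ (pairVar X Z) (x, z) := fun x z => (probEq_pair_eq_sum_middle hX hY hZ x z).symm
  have sYZ : ∀ y z, ∑ x, probEq μ (pairVar X (pairVar Y Z)) (x, (y, z)) =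
      probEq μ (pairVar Y Z) (y, z) := fun y z => (probEq_eq_sum_left hX (hY.pairVar hZ) _).symm
  have sX : ∀ z, ∑ x, probEq μ (pairVar X Z) (x, z) = probEq μ Z z :=
    fun z => (probEq_eq_sum_left hX hZ _).symm
  have sY : ∀ z, ∑ y, probEq μ (pairVar Y Z) (y, z) = probEq μ Z z :=
    fun z => (probEq_eq_sum_left hY hZ _).symm
  simp only [mul_add, mul_sub, Finset.sum_add_distrib, Finset.sum_sub_distrib]
  have t1 : ∑ x, ∑ y, ∑ z, probEq μ (pairVar X (pairVar Y Z)) (x, (y, z)) *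
      Real.log (probEq μ (pairVar X (pairVar Y Z)) (x, (y, z))) =
      - varEntropy μ (pairVar X (pairVar Y Z)) := by
    simp [varEntropy, Real.negMulLog, Fintype.sum_prod_type]
  have t2 : ∑ x, ∑ y, ∑ z, probEq μ (pairVar X (pairVar Y Z)) (x, (y, z)) *
      Real.log (probEq μ (pairVar X Z) (x, z)) = - varEntropy μ (pairVar X Z) := by
    simp only [varEntropy, Real.negMulLog, Fintype.sum_prod_type, neg_mul, Finset.sum_neg_distrib,
      neg_neg]
    refine Finset.sum_congr rfl fun x _ => ?_
    rw [Finset.sum_comm]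
    exact Finset.sum_congr rfl fun z _ => by rw [← Finset.sum_mul, sXZ]
  have t3 : ∑ x, ∑ y, ∑ z, probEq μ (pairVar X (pairVar Y Z)) (x, (y, z)) *
      Real.log (probEq μ (pairVar Y Z) (y, z)) = - varEntropy μ (pairVar Y Z) := by
    simp only [varEntropy, Real.negMulLog, Fintype.sum_prod_type, neg_mul, Finset.sum_neg_distrib,
      neg_neg]
    rw [Finset.sum_comm]
    refine Finset.sum_congr rfl fun y _ => ?_
    rw [Finset.sum_comm]
    exact Finset.sum_congr rfl fun z _ => by rw [← Finset.sum_mul, sYZ]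
  have t4 : ∑ x, ∑ y, ∑ z, probEq μ (pairVar X (pairVar Y Z)) (x, (y, z)) *
      Real.log (probEq μ Z z) = - varEntropy μ Z := by
    simp only [varEntropy, Real.negMulLog, neg_mul, Finset.sum_neg_distrib, neg_neg]
    rw [Finset.sum_comm' (t' := Finset.univ) (s' := fun _ => Finset.univ) (by simp)]
    have : ∀ y, ∑ x, ∑ z, probEq μ (pairVar X (pairVar Y Z)) (x, (y, z)) *
        Real.log (probEq μ Z z) = ∑ z, probEq μ (pairVar Y Z) (y, z) * Real.log (probEq μ Z z) := by
      intro y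
      rw [Finset.sum_comm]
      exact Finset.sum_congr rfl fun z _ => by rw [← Finset.sum_mul, sYZ]
    simp only [this]
    rw [Finset.sum_comm]
    exact Finset.sum_congr rfl fun z _ => by rw [← Finset.sum_mul, sY]
  have t5 : ∑ x, ∑ y, ∑ z, probEq μ (pairVar X (pairVar Y Z)) (x, (y, z)) = 1 := by
    rw [← sum_probEq (μ := μ) (hX.pairVar (hY.pairVar hZ))]
    simp [Fintype.sum_prod_type]
  have t6 : ∑ x, ∑ y, ∑ z, probEq μ (pairVar X Z) (x, z) * probEq μ (pairVar Y Z) (y, z) /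
      probEq μ Z z = 1 := by
    rw [← sum_probEq (μ := μ) hZ]
    have : ∀ x, ∑ y, ∑ z, probEq μ (pairVar X Z) (x, z) * probEq μ (pairVar Y Z) (y, z) /
        probEq μ Z z = ∑ z, probEq μ (pairVar X Z) (x, z) := by
      intro x
      rw [Finset.sum_comm]
      refine Finset.sum_congr rfl fun z _ => ?_
      rw [← Finset.sum_div, ← Finset.mul_sum, sY]
      -- the junk value of the quotient at `P(z) = 0` is harmless, as `P(x, z) = 0` there
      refine mul_div_cancel_of_imp fun h0 => le_antisymm ?_ (probEq_nonneg _)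
      exact (probEq_pair_le_right x z).trans_eq h0
    simp only [this]
    rw [Finset.sum_comm]
    exact Finset.sum_congr rfl fun z _ => sX z
  rw [t1, t2, t3, t4, t5, t6]
  ring

/-- Nonnegativity of the mutual information, together with the case of equality. -/
theorem condMutualInfo_nonneg_and (hX : IsDiscreteVar X) (hY : IsDiscreteVar Y)
    (hZ : IsDiscreteVar Z) :
    0 ≤ condMutualInfo μ X Y Z ∧ (condMutualInfo μ X Y Z = 0 ↔ CondIndepVar μ X Y Z) := by
  rw [condMutualInfo_eq_sum hX hY hZ]
  have key := fun x y z => mul_log_add_sub_nonneg (probEq_nonneg (μ := μ) _)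
    (probEq_triple_le (μ := μ) (X := X) (Y := Y) (Z := Z) x y z)
    (probEq_pair_le_right (μ := μ) (X := X) (Y := pairVar Y Z) x (y, z))
    (probEq_pair_le_right (μ := μ) (X := X) (Y := Z) x z)
  constructor
  · exact Finset.sum_nonneg fun x _ => Finset.sum_nonneg fun y _ => Finset.sum_nonneg fun z _ =>
      (key x y z).1
  · rw [Finset.sum_eq_zero_iff_of_nonneg fun x _ => Finset.sum_nonneg fun y _ =>
      Finset.sum_nonneg fun z _ => (key x y z).1]
    refine forall_congr' fun x => ?_
    rw [Finset.sum_eq_zero_iff_of_nonneg fun y _ => Finset.sum_nonneg fun z _ => (key x y z).1]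
    simp only [Finset.mem_univ, true_imp_iff]
    refine forall_congr' fun y => ?_
    rw [Finset.sum_eq_zero_iff_of_nonneg fun z _ => (key x y z).1]
    simp only [Finset.mem_univ, true_imp_iff]
    exact forall_congr' fun z => (key x y z).2

theorem condMutualInfo_nonneg (hX : IsDiscreteVar X) (hY : IsDiscreteVar Y)
    (hZ : IsDiscreteVar Z) : 0 ≤ condMutualInfo μ X Y Z :=
  (condMutualInfo_nonneg_and hX hY hZ).1

theorem condMutualInfo_eq_zero_iff (hX : IsDiscreteVar X) (hY : IsDiscreteVar Y)
    (hZ : IsDiscreteVar Z) : condMutualInfo μ X Y Z = 0 ↔ CondIndepVar μ X Y Z :=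
  (condMutualInfo_nonneg_and hX hY hZ).2

end Information

section Family

variable {ι : Type} [DecidableEq ι] {T : ι → Type} [∀ i, Fintype (T i)]

/-- The joint entropy of the members of a family of random variables with index in `A`. -/
noncomputable def famEntropy (μ : Measure Ω) (F : (i : ι) → Ω → T i) (A : Finset ι) : ℝ :=
  varEntropy μ fun ω (i : {i // i ∈ A}) => F i ω

/-- `X` generates the same partition as the members of the family `F` with index in `A`. -/
def IsJointVar (F : (i : ι) → Ω → T i) (X : Ω → α) (A : Finset ι) : Prop :=
  ∀ ω ω', X ω = X ω' ↔ ∀ i ∈ A, F i ω = F i ω'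

variable {F : (i : ι) → Ω → T i}

omit [MeasurableSpace Ω] [DecidableEq ι] [∀ i, Fintype (T i)] in
theorem isJointVar_restrict (F : (i : ι) → Ω → T i) (A : Finset ι) :
    IsJointVar F (fun ω (i : {i // i ∈ A}) => F i ω) A := by
  intro ω ω'
  simp [funext_iff]

omit [MeasurableSpace Ω] [DecidableEq ι] [∀ i, Fintype (T i)] in
theorem isJointVar_single (F : (i : ι) → Ω → T i) (i : ι) : IsJointVar F (F i) {i} := by
  intro ω ω'
  simp

omit [MeasurableSpace Ω] [∀ i, Fintype (T i)] in
theorem IsJointVar.pairVar {A B : Finset ι} (hX : IsJointVar F X A) (hY : IsJointVar F Y B) :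
    IsJointVar F (pairVar X Y) (A ∪ B) := by
  intro ω ω'
  simp only [_root_.pairVar, Prod.mk.injEq, hX ω ω', hY ω ω', Finset.mem_union, or_imp,
    forall_and]

omit [IsProbabilityMeasure μ] in
theorem IsJointVar.varEntropy_eq [Fintype α] {A : Finset ι} (hX : IsJointVar F X A) :
    varEntropy μ X = famEntropy μ F A :=
  varEntropy_congr fun ω ω' => (hX ω ω').trans (isJointVar_restrict F A ω ω').symm

variable [Fintype α] [Fintype β] [Fintype γ]

theorem condMutualInfo_eq_famEntropy (hX : IsDiscreteVar X) (hY : IsDiscreteVar Y)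
    (hZ : IsDiscreteVar Z) {A B C : Finset ι} (hA : IsJointVar F X A) (hB : IsJointVar F Y B)
    (hC : IsJointVar F Z C) :
    condMutualInfo μ X Y Z = famEntropy μ F (A ∪ C) + famEntropy μ F (B ∪ C) -
      famEntropy μ F (A ∪ B ∪ C) - famEntropy μ F C := by
  rw [condMutualInfo_eq_varEntropy hX hY hZ, (hA.pairVar hC).varEntropy_eq,
    (hB.pairVar hC).varEntropy_eq, (hA.pairVar (hB.pairVar hC)).varEntropy_eq, hC.varEntropy_eq,
    Finset.union_assoc]

theorem condMutualInfo_eq_zero_iff_famEntropy (hX : IsDiscreteVar X) (hY : IsDiscreteVar Y)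
    (hZ : IsDiscreteVar Z) {A B C : Finset ι} (hA : IsJointVar F X A) (hB : IsJointVar F Y B)
    (hC : IsJointVar F Z C) :
    condMutualInfo μ X Y Z = 0 ↔ CondIndepFor (famEntropy μ F) A B C := by
  rw [condMutualInfo_eq_famEntropy hX hY hZ hA hB hC, CondIndepFor]
  constructor <;> intro h <;> linarith

theorem isSubmodular_famEntropy (hF : ∀ i, IsDiscreteVar (F i)) :
    IsSubmodular (famEntropy μ F) := by
  intro A B C
  have d : ∀ A : Finset ι, IsDiscreteVar fun ω (i : {i // i ∈ A}) => F i ω :=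
    fun A => IsDiscreteVar.pi fun i => hF i
  have h := condMutualInfo_nonneg (μ := μ) (d A) (d B) (d C)
  rw [condMutualInfo_eq_famEntropy (d A) (d B) (d C) (isJointVar_restrict F A)
    (isJointVar_restrict F B) (isJointVar_restrict F C)] at h
  linarith

/-- If, up to null events, the value of `X` determines the value of `V`, then `X` determines `V` in
terms of entropies. -/
theorem determines_of_probEq (hF : ∀ i, IsDiscreteVar (F i)) (i k : ι)
    (h : ∀ x v v', 0 < probEq μ (pairVar (F k) (F i)) (v, x) →
      0 < probEq μ (pairVar (F k) (F i)) (v', x) → v = v') :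
    Determines (famEntropy μ F) {i} {k} := by
  refine Determines.of_condIndepFor (isSubmodular_famEntropy hF) ?_
  refine (condMutualInfo_eq_zero_iff_famEntropy (hF k) (hF k) (hF i) (isJointVar_single F k)
    (isJointVar_single F k) (isJointVar_single F i)).1 ?_
  refine (condMutualInfo_eq_zero_iff (hF k) (hF k) (hF i)).2 ?_
  intro v v' x
  have h0 : ∀ v v' x, v ≠ v' →
      probEq μ (pairVar (F k) (pairVar (F k) (F i))) (v, (v', x)) = 0 := by
    intro v v' x hne
    have e : pairVar (F k) (pairVar (F k) (F i)) ⁻¹' {(v, (v', x))} = ∅ := by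
      ext ω
      simp only [pairVar, Set.mem_preimage, Set.mem_singleton_iff, Prod.mk.injEq,
        Set.mem_empty_iff_false, iff_false]
      rintro ⟨h1, h2, -⟩
      exact hne (h1.symm.trans h2)
    simp [probEq, e]
  rcases (probEq_nonneg (μ := μ) (X := pairVar (F k) (F i)) (v, x)).eq_or_lt with hv | hv
  · have h1 := probEq_triple_le (μ := μ) (X := F k) (Y := F k) (Z := F i) v v' x
    have h2 := probEq_nonneg (μ := μ) (X := pairVar (F k) (pairVar (F k) (F i))) (v, (v', x))
    rw [← hv] at h1 ⊢
    rw [le_antisymm h1 h2]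
    simp
  · have hx : probEq μ (F i) x = probEq μ (pairVar (F k) (F i)) (v, x) := by
      rw [probEq_eq_sum_left (hF k) (hF i)]
      refine Finset.sum_eq_single v (fun w _ hw => ?_) (by simp)
      by_contra hne
      exact hw (h x w v (lt_of_le_of_ne (probEq_nonneg _) (Ne.symm hne)) hv)
    by_cases hvv : v = v'
    · subst hvv
      have e : probEq μ (pairVar (F k) (pairVar (F k) (F i))) (v, (v, x)) =
          probEq μ (pairVar (F k) (F i)) (v, x) := by
        unfold probEq
        congr 1
        ext ω
        simp [pairVar]
      rw [e, hx]
    · rw [h0 v v' x hvv, zero_mul]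
      symm
      refine mul_eq_zero_of_right _ ?_
      by_contra hne
      exact hvv (h x v v' hv (lt_of_le_of_ne (probEq_nonneg _) (Ne.symm hne)))

end Family

end Entropy

/-! ### The common part of three random variables -/

section CommonPart

open MeasureTheory

variable {Ω : Type} [MeasurableSpace Ω] {α β γ : Type}

/-- The values of `Z` that are compatible with the value `x` of `X`. -/
def compatibleValues (μ : Measure Ω) (X : Ω → α) (Z : Ω → γ) (x : α) : Set γ :=
  {z | 0 < probEq μ (pairVar X Z) (x, z)}

/-- A representative of the class of those values of `X` that are compatible with the same values
of `Z`. -/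
noncomputable def commonRep (μ : Measure Ω) (X : Ω → α) (Z : Ω → γ) (x : α) : α :=
  (Quotient.mk (Setoid.ker (compatibleValues μ X Z)) x).out

theorem commonRep_eq_iff {μ : Measure Ω} {X : Ω → α} {Z : Ω → γ} {x x' : α} :
    commonRep μ X Z x = commonRep μ X Z x' ↔
      compatibleValues μ X Z x = compatibleValues μ X Z x' := by
  unfold commonRep
  rw [Quotient.out_inj, Quotient.eq]
  rfl

variable {μ : Measure Ω} [IsProbabilityMeasure μ] {X : Ω → α} {Y : Ω → β} {Z : Ω → γ}

/-- Three random variables each two of which are independent given the third. -/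
structure IsDoubleMarkov (μ : Measure Ω) (X : Ω → α) (Y : Ω → β) (Z : Ω → γ) : Prop where
  left_right : CondIndepVar μ X Z Y
  left_middle : CondIndepVar μ X Y Z
  middle_right : CondIndepVar μ Y Z X

namespace IsDoubleMarkov

omit [IsProbabilityMeasure μ] in
/-- In the compatibility relation between values of `X`, `Y` and `Z`, a path of length two through
`x` spans a triangle. -/
theorem pos_left (H : IsDoubleMarkov μ X Y Z) {x : α} {y : β} {z : γ}
    (h1 : 0 < probEq μ (pairVar X Y) (x, y)) (h2 : 0 < probEq μ (pairVar X Z) (x, z)) :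
    0 < probEq μ (pairVar X (pairVar Y Z)) (x, (y, z)) := by
  have h := H.middle_right y z x
  rw [probEq_swap x y, probEq_swap x z] at h
  have e : probEq μ (pairVar Y (pairVar Z X)) (y, (z, x)) =
      probEq μ (pairVar X (pairVar Y Z)) (x, (y, z)) := by
    unfold probEq; congr 1; ext ω; simp [pairVar]; tauto
  rw [e] at h
  exact pos_of_mul_pos_left (h ▸ mul_pos h1 h2) (probEq_nonneg _)

omit [IsProbabilityMeasure μ] in
theorem pos_middle (H : IsDoubleMarkov μ X Y Z) {x : α} {y : β} {z : γ}
    (h1 : 0 < probEq μ (pairVar X Y) (x, y)) (h2 : 0 < probEq μ (pairVar Y Z) (y, z)) :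
    0 < probEq μ (pairVar X (pairVar Y Z)) (x, (y, z)) := by
  have h := H.left_right x z y
  rw [probEq_swap y z] at h
  have e : probEq μ (pairVar X (pairVar Z Y)) (x, (z, y)) =
      probEq μ (pairVar X (pairVar Y Z)) (x, (y, z)) := by
    unfold probEq; congr 1; ext ω; simp [pairVar]; tauto
  rw [e] at h
  exact pos_of_mul_pos_left (h ▸ mul_pos h1 h2) (probEq_nonneg _)

omit [IsProbabilityMeasure μ] in
theorem pos_right (H : IsDoubleMarkov μ X Y Z) {x : α} {y : β} {z : γ}
    (h1 : 0 < probEq μ (pairVar X Z) (x, z)) (h2 : 0 < probEq μ (pairVar Y Z) (y, z)) :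
    0 < probEq μ (pairVar X (pairVar Y Z)) (x, (y, z)) :=
  pos_of_mul_pos_left (H.left_middle x y z ▸ mul_pos h1 h2) (probEq_nonneg _)

theorem pos_pair_left {x : α} {y : β} {z : γ}
    (h : 0 < probEq μ (pairVar X (pairVar Y Z)) (x, (y, z))) :
    0 < probEq μ (pairVar X Y) (x, y) ∧ 0 < probEq μ (pairVar X Z) (x, z) ∧
      0 < probEq μ (pairVar Y Z) (y, z) := by
  refine ⟨h.trans_le ?_, h.trans_le (probEq_triple_le x y z),
    h.trans_le (probEq_pair_le_right x (y, z))⟩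
  refine measureReal_mono fun ω => ?_
  simp +contextual [pairVar]

/-- The class of `X` is almost surely determined by `Y`. -/
theorem commonRep_eq_of_middle (H : IsDoubleMarkov μ X Y Z) {x x' : α} {y : β}
    (h : 0 < probEq μ (pairVar X Y) (x, y)) (h' : 0 < probEq μ (pairVar X Y) (x', y)) :
    commonRep μ X Z x = commonRep μ X Z x' := by
  have key : ∀ x, 0 < probEq μ (pairVar X Y) (x, y) →
      compatibleValues μ X Z x = compatibleValues μ Y Z y := by
    intro x hx
    ext z
    exact ⟨fun hz => (pos_pair_left (H.pos_left hx hz)).2.2,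
      fun hz => (pos_pair_left (H.pos_middle hx hz)).2.1⟩
  rw [commonRep_eq_iff, key x h, key x' h']

variable [Fintype α] [Fintype β] [Fintype γ]

theorem exists_middle (hX : IsDiscreteVar X) (hY : IsDiscreteVar Y) (hZ : IsDiscreteVar Z) {x : α}
    {z : γ} (h : 0 < probEq μ (pairVar X Z) (x, z)) :
    ∃ y, 0 < probEq μ (pairVar X (pairVar Y Z)) (x, (y, z)) := by
  by_contra! hy
  rw [probEq_pair_eq_sum_middle hX hY hZ] at h
  exact absurd h (not_lt.2 (Finset.sum_nonpos fun y _ => hy y))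

/-- The class of `X` is almost surely determined by `Z`. -/
theorem commonRep_eq_of_right (H : IsDoubleMarkov μ X Y Z) (hX : IsDiscreteVar X)
    (hY : IsDiscreteVar Y) (hZ : IsDiscreteVar Z) {x x' : α} {z : γ}
    (h : 0 < probEq μ (pairVar X Z) (x, z)) (h' : 0 < probEq μ (pairVar X Z) (x', z)) :
    commonRep μ X Z x = commonRep μ X Z x' := by
  obtain ⟨y, hy⟩ := exists_middle hX hY hZ h
  have hp := pos_pair_left hy
  exact H.commonRep_eq_of_middle hp.1 (pos_pair_left (H.pos_right h' hp.2.2)).1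

/-- The conditional probability of `x` given `z` is the same for all `z` compatible with `x`. -/
theorem probEq_mul_eq (H : IsDoubleMarkov μ X Y Z) (hX : IsDiscreteVar X)
    (hY : IsDiscreteVar Y) (hZ : IsDiscreteVar Z) {x : α} {z z' : γ}
    (h : 0 < probEq μ (pairVar X Z) (x, z)) (h' : 0 < probEq μ (pairVar X Z) (x, z')) :
    probEq μ (pairVar X Z) (x, z) * probEq μ Z z' =
      probEq μ (pairVar X Z) (x, z') * probEq μ Z z := by
  obtain ⟨y, hy⟩ := exists_middle hX hY hZ h
  have hxy := (pos_pair_left hy).1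
  have hy' := H.pos_left hxy h'
  -- `P(x | z) = P(x | y, z) = P(x | y)`, where the last expression does not involve `z`
  have key : ∀ z, 0 < probEq μ (pairVar X (pairVar Y Z)) (x, (y, z)) →
      probEq μ (pairVar X Z) (x, z) * probEq μ Y y =
        probEq μ (pairVar X Y) (x, y) * probEq μ Z z := by
    intro z hz
    have h1 := H.left_middle x y z
    have h2 := H.left_right x z y
    have e : probEq μ (pairVar X (pairVar Z Y)) (x, (z, y)) =
        probEq μ (pairVar X (pairVar Y Z)) (x, (y, z)) := by
      unfold probEq; congr 1; ext ω; simp [pairVar]; tauto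
    rw [e, probEq_swap y z] at h2
    refine mul_right_cancel₀ (mul_pos hz (pos_pair_left hz).2.2).ne' ?_
    linear_combination (probEq μ (pairVar X Z) (x, z) * probEq μ (pairVar Y Z) (y, z)) * h2 -
      (probEq μ (pairVar X Y) (x, y) * probEq μ (pairVar Y Z) (y, z)) * h1
  have hyp : 0 < probEq μ Y y := hxy.trans_le (probEq_pair_le_right x y)
  refine mul_right_cancel₀ hyp.ne' ?_
  linear_combination probEq μ Z z' * key z hy - probEq μ Z z * key z' hy'

/-- `X` and `Z` are independent given the class of `X`. -/
theorem condIndepVar_commonRep (H : IsDoubleMarkov μ X Y Z) (hX : IsDiscreteVar X)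
    (hY : IsDiscreteVar Y) (hZ : IsDiscreteVar Z) :
    CondIndepVar μ X Z fun ω => commonRep μ X Z (X ω) := by
  set V : Ω → α := fun ω => commonRep μ X Z (X ω) with hV
  have dV : IsDiscreteVar V := hX.comp _
  intro x z v
  by_cases hxv : commonRep μ X Z x = v
  swap
  · have e1 : pairVar X V ⁻¹' {(x, v)} = ∅ := by
      ext ω
      simp only [pairVar, Set.mem_preimage, Set.mem_singleton_iff, Prod.mk.injEq,
        Set.mem_empty_iff_false, iff_false]
      rintro ⟨rfl, h⟩
      exact hxv h
    have e2 : pairVar X (pairVar Z V) ⁻¹' {(x, (z, v))} = ∅ := by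
      rw [Set.eq_empty_iff_forall_notMem] at e1 ⊢
      intro ω
      have := e1 ω
      simp only [pairVar, Set.mem_preimage, Set.mem_singleton_iff, Prod.mk.injEq] at this ⊢
      tauto
    simp [probEq, e1, e2]
  have e1 : probEq μ (pairVar X V) (x, v) = probEq μ X x := by
    unfold probEq; congr 1; ext ω
    simp only [pairVar, Set.mem_preimage, Set.mem_singleton_iff, Prod.mk.injEq, and_iff_left_iff_imp]
    rintro rfl
    exact hxv
  have e2 : ∀ z, probEq μ (pairVar X (pairVar Z V)) (x, (z, v)) =
      probEq μ (pairVar X Z) (x, z) := by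
    intro z
    unfold probEq; congr 1; ext ω
    simp only [pairVar, Set.mem_preimage, Set.mem_singleton_iff, Prod.mk.injEq]
    constructor
    · tauto
    · rintro ⟨rfl, rfl⟩
      exact ⟨rfl, rfl, hxv⟩
  -- for `x` in the class `v`, the event `Z = z` lies in `V = v` if `z` is compatible with `x`, and
  -- is disjoint from it otherwise, up to null events
  have hpos : ∀ z, 0 < probEq μ (pairVar X Z) (x, z) →
      probEq μ (pairVar Z V) (z, v) = probEq μ Z z := by
    intro z hz
    rw [probEq_eq_sum_right hZ dV]
    symm
    refine Finset.sum_eq_single v (fun w _ hw => ?_) (by simp)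
    by_contra hne
    have hpz : 0 < probEq μ (pairVar Z V) (z, w) := lt_of_le_of_ne (probEq_nonneg _) (Ne.symm hne)
    rw [probEq_eq_sum_left hX (hZ.pairVar dV)] at hpz
    obtain ⟨x', -, hx'⟩ := Finset.exists_ne_zero_of_sum_ne_zero hpz.ne'
    replace hx' := lt_of_le_of_ne (probEq_nonneg _) (Ne.symm hx')
    have h1 : 0 < probEq μ (pairVar X Z) (x', z) := (pos_pair_left hx').1
    have h2 : commonRep μ X Z x' = w := by
      by_contra hne'
      have e : pairVar X (pairVar Z V) ⁻¹' {(x', (z, w))} = ∅ := by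
        ext ω
        simp only [pairVar, Set.mem_preimage, Set.mem_singleton_iff, Prod.mk.injEq,
          Set.mem_empty_iff_false, iff_false]
        rintro ⟨rfl, -, h⟩
        exact hne' h
      simp [probEq, e] at hx'
    exact hw (by rw [← h2, ← hxv, H.commonRep_eq_of_right hX hY hZ h1 hz])
  have hzero : ∀ z, probEq μ (pairVar X Z) (x, z) = 0 → probEq μ (pairVar Z V) (z, v) = 0 := by
    intro z hz
    by_contra hne
    have hpz : 0 < probEq μ (pairVar Z V) (z, v) := lt_of_le_of_ne (probEq_nonneg _) (Ne.symm hne)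
    rw [probEq_eq_sum_left hX (hZ.pairVar dV)] at hpz
    obtain ⟨x', -, hx'⟩ := Finset.exists_ne_zero_of_sum_ne_zero hpz.ne'
    replace hx' := lt_of_le_of_ne (probEq_nonneg _) (Ne.symm hx')
    have h1 : z ∈ compatibleValues μ X Z x' := (pos_pair_left hx').1
    have h2 : commonRep μ X Z x' = v := by
      by_contra hne'
      have e : pairVar X (pairVar Z V) ⁻¹' {(x', (z, v))} = ∅ := by
        ext ω
        simp only [pairVar, Set.mem_preimage, Set.mem_singleton_iff, Prod.mk.injEq,
          Set.mem_empty_iff_false, iff_false]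
        rintro ⟨rfl, -, h⟩
        exact hne' h
      simp [probEq, e] at hx'
    rw [commonRep_eq_iff.1 (h2.trans hxv.symm)] at h1
    exact absurd hz (ne_of_gt h1)
  -- the claim is the sum of these identities over `z'`
  have key : ∀ z', probEq μ (pairVar X Z) (x, z) * probEq μ (pairVar Z V) (z', v) =
      probEq μ (pairVar X Z) (x, z') * probEq μ (pairVar Z V) (z, v) := by
    intro z'
    rcases (probEq_nonneg (μ := μ) (X := pairVar X Z) (x, z)).eq_or_lt with h | h
    · rw [hzero z h.symm, ← h, zero_mul, mul_zero]
    rcases (probEq_nonneg (μ := μ) (X := pairVar X Z) (x, z')).eq_or_lt with h' | h'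
    · rw [hzero z' h'.symm, ← h', zero_mul, mul_zero]
    rw [hpos z h, hpos z' h', H.probEq_mul_eq hX hY hZ h h']
  rw [e1, e2, probEq_eq_sum_left hZ dV, Finset.mul_sum, probEq_eq_sum_right hX hZ x,
    Finset.sum_mul]
  exact Finset.sum_congr rfl fun z' _ => key z'

end IsDoubleMarkov

end CommonPart

/-! ### The reduction -/

section Reduction

/-- The set of those indices `3 j + k` for which `s j k` holds: the index `3 j + k` stands for the
`k`-th copy of the `j`-th variable. -/
def blockSet {n : ℕ} (s : Fin n → Fin 3 → Bool) : Finset (Fin (n * 3)) :=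
  Finset.univ.filter fun i => s i.divNat i.modNat

theorem mem_blockSet {n : ℕ} {s : Fin n → Fin 3 → Bool} {i : Fin (n * 3)} :
    i ∈ blockSet s ↔ s i.divNat i.modNat = true := by
  simp [blockSet]

/-- The index of the `k`-th copy of the `j`-th variable. -/
def blockIdx {n : ℕ} (j : Fin n) (k : Fin 3) : Fin (n * 3) :=
  finProdFinEquiv (j, k)

theorem divNat_blockIdx {n : ℕ} (j : Fin n) (k : Fin 3) : (blockIdx j k).divNat = j :=
  congrArg Prod.fst (finProdFinEquiv.symm_apply_apply (j, k))

theorem modNat_blockIdx {n : ℕ} (j : Fin n) (k : Fin 3) : (blockIdx j k).modNat = k :=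
  congrArg Prod.snd (finProdFinEquiv.symm_apply_apply (j, k))

theorem blockIdx_divNat_modNat {n : ℕ} (i : Fin (n * 3)) : blockIdx i.divNat i.modNat = i :=
  finProdFinEquiv.apply_symm_apply i

theorem forall_mem_blockSet {n : ℕ} {s : Fin n → Fin 3 → Bool} {P : Fin (n * 3) → Prop} :
    (∀ i ∈ blockSet s, P i) ↔ ∀ j k, s j k = true → P (blockIdx j k) := by
  constructor
  · intro h j k hs
    refine h _ (mem_blockSet.2 ?_)
    rwa [divNat_blockIdx, modNat_blockIdx]
  · intro h i hi
    rw [← blockIdx_divNat_modNat i]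
    exact h _ _ (mem_blockSet.1 hi)

theorem disjoint_blockSet {n : ℕ} {s t : Fin n → Fin 3 → Bool}
    (h : ∀ j k, ¬ (s j k = true ∧ t j k = true)) : Disjoint (blockSet s) (blockSet t) :=
  Finset.disjoint_left.2 fun _ h1 h2 => h _ _ ⟨mem_blockSet.1 h1, mem_blockSet.1 h2⟩

/-- The statement about the original variables, with its three sets placed on different copies. -/
def CITriple.spread {n : ℕ} (t : CITriple n) : CITriple (n * 3) where
  A := blockSet fun j k => decide (j ∈ t.A) && decide (k = 0)
  B := blockSet fun j k => decide (j ∈ t.B) && decide (k = 1)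
  C := blockSet fun j k => decide (j ∈ t.C) && decide (k = 2)

/-- Given the second copy in `copyPair p` of the `j`-th variable, the first one is independent of
all other copies of all variables. -/
def markovTriple {n : ℕ} (j : Fin n) (p : Fin 4) : CITriple (n * 3) where
  A := blockSet fun i k => decide (i = j) && decide (k = (copyPair p).1)
  B := blockSet fun i k =>
    !decide (i = j) || (!decide (k = (copyPair p).1) && !decide (k = (copyPair p).2))
  C := blockSet fun i k => decide (i = j) && decide (k = (copyPair p).2)

theorem CITriple.isDisjoint_spread {n : ℕ} (t : CITriple n) : t.spread.IsDisjoint := by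
  refine ⟨disjoint_blockSet ?_, disjoint_blockSet ?_, disjoint_blockSet ?_⟩ <;>
  · intro j k
    fin_cases k <;> simp

theorem isDisjoint_markovTriple {n : ℕ} (j : Fin n) (p : Fin 4) :
    (markovTriple j p).IsDisjoint := by
  refine ⟨disjoint_blockSet ?_, disjoint_blockSet ?_, disjoint_blockSet ?_⟩ <;>
  · intro i k
    by_cases h : i = j <;> fin_cases p <;> fin_cases k <;> simp [h, copyPair]

/-- The implication with three copies of each variable. -/
def BoundedCI.triplicate (R : BoundedCI) : BoundedCI where
  n := R.n * 3
  antecedents := ((List.finRange R.n).flatMap fun j => (List.finRange 4).map (markovTriple j)) ++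
    R.antecedents.map CITriple.spread
  consequent := R.consequent.spread
  bound i := R.bound i.divNat

theorem BoundedCI.mem_antecedents_triplicate {R : BoundedCI} {t : CITriple (R.n * 3)} :
    t ∈ R.triplicate.antecedents ↔
      (∃ j p, markovTriple j p = t) ∨ ∃ u ∈ R.antecedents, u.spread = t := by
  change t ∈ (((List.finRange R.n).flatMap fun j => (List.finRange 4).map (markovTriple j)) ++
    R.antecedents.map CITriple.spread) ↔ _
  simp

theorem BoundedCI.isDisjoint_triplicate (R : BoundedCI) :
    ∀ t ∈ R.triplicate.triples, t.IsDisjoint := by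
  intro t ht
  rcases List.mem_append.1 ht with ht | ht
  · rcases mem_antecedents_triplicate.1 ht with ⟨j, p, rfl⟩ | ⟨t, -, rfl⟩
    · exact isDisjoint_markovTriple j p
    · exact t.isDisjoint_spread
  · rw [List.mem_singleton.1 ht]
    exact CITriple.isDisjoint_spread _

theorem BoundedCI.range_bound_triplicate (R : BoundedCI) :
    Set.range R.triplicate.bound = Set.range R.bound := by
  ext b
  constructor
  · rintro ⟨i, rfl⟩
    exact ⟨_, rfl⟩
  · rintro ⟨j, rfl⟩
    exact ⟨blockIdx j 0, congrArg R.bound (divNat_blockIdx j 0)⟩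

/-! ### Validity of the reduction -/

open MeasureTheory

variable {Ω : Type} [MeasurableSpace Ω] {μ : Measure Ω} [IsProbabilityMeasure μ]

/-- A statement about variables that are measurable with respect to another family `F`, in terms
of the entropies of `F`. -/
theorem CITriple.holds_iff {ι : Type} [DecidableEq ι] {T : ι → Type} [∀ i, Fintype (T i)]
    (F : (i : ι) → Ω → T i) {n : ℕ} {S : Fin n → Type} [∀ j, Fintype (S j)]
    {X : (j : Fin n) → Ω → S j} (hX : ∀ j, IsDiscreteVar (X j)) {t : CITriple n} {A B C : Finset ι}
    (hA : IsJointVar F (subVar X t.A) A) (hB : IsJointVar F (subVar X t.B) B)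
    (hC : IsJointVar F (subVar X t.C) C) :
    t.Holds μ X ↔ CondIndepFor (famEntropy μ F) A B C := by
  have d : ∀ A : Finset (Fin n), IsDiscreteVar (subVar X A) :=
    fun A => IsDiscreteVar.pi fun i : {i // i ∈ A} => hX i
  exact condMutualInfo_eq_zero_iff_famEntropy (d _) (d _) (d _) hA hB hC

omit [MeasurableSpace Ω] in
/-- A block of copies generates the same partition as the set `A` of members of `F` if every copy
in the block is a member with index in `A` and vice versa. -/
theorem isJointVar_blockSet {ι : Type} {T : ι → Type} (F : (i : ι) → Ω → T i) {n : ℕ}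
    {S : Fin (n * 3) → Type} (X : (j : Fin (n * 3)) → Ω → S j) (idx : Fin n → Fin 3 → ι)
    (hidx : ∀ j k ω ω', F (idx j k) ω = F (idx j k) ω' ↔ X (blockIdx j k) ω = X (blockIdx j k) ω')
    (s : Fin n → Fin 3 → Bool) (A : Finset ι) (hA : ∀ i, i ∈ A ↔ ∃ j k, s j k ∧ idx j k = i) :
    IsJointVar F (subVar X (blockSet s)) A := by
  intro ω ω'
  have h1 : subVar X (blockSet s) ω = subVar X (blockSet s) ω' ↔
      ∀ i ∈ blockSet s, X i ω = X i ω' := by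
    simp [subVar, funext_iff]
  rw [h1, forall_mem_blockSet]
  constructor
  · intro h i hi
    obtain ⟨j, k, hs, rfl⟩ := (hA i).1 hi
    exact (hidx j k ω ω').2 (h j k hs)
  · intro h j k hs
    exact (hidx j k ω ω').1 (h _ ((hA _).2 ⟨j, k, hs, rfl⟩))

/-- Equal copies of the variables are a model of the added antecedents. -/
theorem BoundedCI.valid_of_valid_triplicate {R : BoundedCI} (h : R.triplicate.Valid) :
    R.Valid := by
  intro Ω _ μ _ S _ _ _ X hX hcard hant
  have hd : ∀ j, IsDiscreteVar (X j) := fun j => IsDiscreteVar.of_measurable (hX j)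
  have hjoint : ∀ (s : Fin R.n → Fin 3 → Bool) (A : Finset (Fin R.n)),
      (∀ i, i ∈ A ↔ ∃ k, s i k) →
      IsJointVar X (subVar (fun i : Fin (R.n * 3) => X i.divNat) (blockSet s)) A := by
    intro s A hA
    refine isJointVar_blockSet X (fun i : Fin (R.n * 3) => X i.divNat) (fun j _ => j)
      (fun j k ω ω' => ?_) s A fun i => ?_
    · have h1 : ∀ i, i = j → (X j ω = X j ω' ↔ X i ω = X i ω') := by
        rintro _ rfl
        rfl
      exact h1 _ (divNat_blockIdx j k)
    · rw [hA i]
      constructor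
      · rintro ⟨k, hk⟩
        exact ⟨i, k, hk, rfl⟩
      · rintro ⟨j, k, hk, rfl⟩
        exact ⟨k, hk⟩
  have hspread : ∀ t : CITriple R.n,
      t.spread.Holds μ (fun i : Fin (R.n * 3) => X i.divNat) ↔ t.Holds μ X := by
    intro t
    rw [t.holds_iff X hd (isJointVar_restrict X t.A) (isJointVar_restrict X t.B)
      (isJointVar_restrict X t.C)]
    refine t.spread.holds_iff X (fun i => hd _) (hjoint _ _ fun i => ?_) (hjoint _ _ fun i => ?_)
      (hjoint _ _ fun i => ?_) <;> simp
  have hmarkov : ∀ j p, (markovTriple j p).Holds μ (fun i : Fin (R.n * 3) => X i.divNat) := by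
    intro j p
    refine ((markovTriple j p).holds_iff X (fun i => hd _) (A := {j}) (B := Finset.univ) (C := {j})
      (hjoint _ _ fun i => ?_) (hjoint _ _ fun i => ?_) (hjoint _ _ fun i => ?_)).2 ?_
    · simp
    · have : ∃ k : Fin 3, k ≠ (copyPair p).1 ∧ k ≠ (copyPair p).2 := by
        fin_cases p <;> decide
      obtain ⟨k, hk⟩ := this
      simp only [Finset.mem_univ, true_iff]
      exact ⟨k, by simp [hk]⟩
    · simp
    · simp [CondIndepFor, add_comm]
  refine (hspread _).1 (@h Ω _ μ _ (fun i : Fin (R.n * 3) => S i.divNat)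
    (fun _ => inferInstance) (fun _ => inferInstance) (fun _ => inferInstance)
    (fun i : Fin (R.n * 3) => X i.divNat) (fun i => hX _) (fun i => hcard _) ?_)
  intro t ht
  rcases mem_antecedents_triplicate.1 ht with ⟨j, p, rfl⟩ | ⟨u, hu, rfl⟩
  · exact hmarkov j p
  · exact (hspread u).2 (hant u hu)

/-- The copies of a family of variables together with the common parts of the copies. -/
noncomputable def copiesWithCommon {n : ℕ} {S : Fin (n * 3) → Type} (μ : Measure Ω)
    (X : (i : Fin (n * 3)) → Ω → S i) :
    (x : Fin n × Option (Fin 3)) → Ω → S (blockIdx x.1 (x.2.getD 0))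
  | (j, some k) => X (blockIdx j k)
  | (j, none) => fun ω => commonRep μ (X (blockIdx j 0)) (X (blockIdx j 2)) (X (blockIdx j 0) ω)

omit [IsProbabilityMeasure μ] in
theorem isDiscreteVar_copiesWithCommon {n : ℕ} {S : Fin (n * 3) → Type}
    {X : (i : Fin (n * 3)) → Ω → S i} (hX : ∀ i, IsDiscreteVar (X i)) :
    ∀ x, IsDiscreteVar (copiesWithCommon μ X x)
  | (_, some _) => hX _
  | (j, none) =>
    (hX (blockIdx j 0)).comp (commonRep μ (X (blockIdx j 0)) (X (blockIdx j 2)))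

omit [IsProbabilityMeasure μ] in
theorem isJointVar_copiesWithCommon {n : ℕ} {S : Fin (n * 3) → Type}
    (X : (i : Fin (n * 3)) → Ω → S i) (s : Fin n → Fin 3 → Bool)
    (A : Finset (Fin n × Option (Fin 3)))
    (hA : ∀ x, x ∈ A ↔ ∃ k, s x.1 k ∧ some k = x.2) :
    IsJointVar (copiesWithCommon μ X) (subVar X (blockSet s)) A := by
  refine isJointVar_blockSet _ X (fun j k => (j, some k)) (fun j k ω ω' => Iff.rfl) s A ?_
  rintro ⟨i, l⟩
  rw [hA]
  constructor
  · rintro ⟨k, hk, rfl⟩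
    exact ⟨i, k, hk, rfl⟩
  · rintro ⟨j, k, hk, h⟩
    obtain ⟨rfl, rfl⟩ := Prod.ext_iff.1 h
    exact ⟨k, hk, rfl⟩

/-- The added antecedents make the double Markov property available for the copies of each
variable. -/
theorem isNoisyCopy_of_markovTriple {n : ℕ} {S : Fin (n * 3) → Type} [∀ i, Fintype (S i)]
    {X : (i : Fin (n * 3)) → Ω → S i} (hX : ∀ i, IsDiscreteVar (X i))
    (h : ∀ (j : Fin n) p, (markovTriple j p).Holds μ X) :
    IsNoisyCopy (famEntropy μ (copiesWithCommon μ X)) := by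
  set F := copiesWithCommon μ X with hF
  have hd : ∀ x, IsDiscreteVar (F x) := isDiscreteVar_copiesWithCommon hX
  have hs : IsSubmodular (famEntropy μ F) := isSubmodular_famEntropy hd
  have hmarkov : ∀ j p, CondIndepFor (famEntropy μ F) {(j, some (copyPair p).1)}
      (allCopies (Fin n) \ {(j, some (copyPair p).1), (j, some (copyPair p).2)})
      {(j, some (copyPair p).2)} := by
    intro j p
    refine ((markovTriple j p).holds_iff F hX (isJointVar_copiesWithCommon X _ _ ?_)
      (isJointVar_copiesWithCommon X _ _ ?_) (isJointVar_copiesWithCommon X _ _ ?_)).1 (h j p)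
    · rintro ⟨i, l⟩
      simp only [Finset.mem_singleton, Prod.mk.injEq, Bool.and_eq_true, decide_eq_true_eq]
      grind
    · rintro ⟨i, l⟩
      rcases l with _ | l
      · simp [mem_allCopies]
      · simp [mem_allCopies]
        tauto
    · rintro ⟨i, l⟩
      simp only [Finset.mem_singleton, Prod.mk.injEq, Bool.and_eq_true, decide_eq_true_eq]
      grind
  have hvar : ∀ j (k l m : Fin 3), CondIndepFor (famEntropy μ F) {(j, some k)} {(j, some l)}
      {(j, some m)} → CondIndepVar μ (X (blockIdx j k)) (X (blockIdx j l)) (X (blockIdx j m)) := by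
    intro j k l m hc
    refine (condMutualInfo_eq_zero_iff (hX _) (hX _) (hX _)).1 ?_
    exact (condMutualInfo_eq_zero_iff_famEntropy (F := F) (hX _) (hX _) (hX _)
      (isJointVar_single F (j, some k)) (isJointVar_single F (j, some l))
      (isJointVar_single F (j, some m))).2 hc
  have hdm : ∀ j, IsDoubleMarkov μ (X (blockIdx j 0)) (X (blockIdx j 1)) (X (blockIdx j 2)) := by
    intro j
    refine ⟨hvar j 0 2 1 ((hmarkov j 1).mono_right hs ?_),
      hvar j 0 1 2 ((hmarkov j 0).mono_right hs ?_),
      hvar j 1 2 0 ((hmarkov j 2).mono_right hs ?_)⟩ <;>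
    simp [copyPair, mem_allCopies]
  refine ⟨hs, hmarkov, fun j k => ?_, fun j => ?_⟩
  · refine determines_of_probEq hd _ _ ?_
    intro x v v' hv hv'
    -- a value of the common part is the class of a value of the copy with index `0`
    have key : ∀ (k : Fin 3) (x : S (blockIdx j k)) (v : S (blockIdx j 0)),
        0 < probEq μ (pairVar (F (j, none)) (X (blockIdx j k))) (v, x) →
        ∃ w, commonRep μ (X (blockIdx j 0)) (X (blockIdx j 2)) w = v ∧
          0 < probEq μ (pairVar (X (blockIdx j 0)) (X (blockIdx j k))) (w, x) := by
      intro k x v hv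
      rw [probEq_eq_sum_left (hX (blockIdx j 0)) ((hd (j, none)).pairVar (hX _))] at hv
      obtain ⟨w, -, hw⟩ := Finset.exists_ne_zero_of_sum_ne_zero hv.ne'
      have hw' := lt_of_le_of_ne (probEq_nonneg _) (Ne.symm hw)
      refine ⟨w, ?_, hw'.trans_le (probEq_triple_le _ _ _)⟩
      by_contra hne
      refine hw ?_
      have e : pairVar (X (blockIdx j 0)) (pairVar (F (j, none)) (X (blockIdx j k))) ⁻¹'
          {(w, (v, x))} = ∅ := by
        ext ω
        simp only [pairVar, Set.mem_preimage, Set.mem_singleton_iff, Prod.mk.injEq,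
          Set.mem_empty_iff_false, iff_false]
        rintro ⟨rfl, h, -⟩
        exact hne h
      simp [probEq, e]
    obtain ⟨w, rfl, hw⟩ := key k x v hv
    obtain ⟨w', rfl, hw'⟩ := key k x v' hv'
    fin_cases k
    · have e : ∀ w, 0 < probEq μ (pairVar (X (blockIdx j 0)) (X (blockIdx j 0))) (w, x) →
          w = x := by
        intro w hw
        by_contra hne
        have e : pairVar (X (blockIdx j 0)) (X (blockIdx j 0)) ⁻¹' {(w, x)} = ∅ := by
          ext ω
          simp only [pairVar, Set.mem_preimage, Set.mem_singleton_iff, Prod.mk.injEq,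
            Set.mem_empty_iff_false, iff_false]
          rintro ⟨h1, h2⟩
          exact hne (h1.symm.trans h2)
        simp [probEq, e] at hw
      rw [e w hw, e w' hw']
    · exact (hdm j).commonRep_eq_of_middle hw hw'
    · exact (hdm j).commonRep_eq_of_right (hX _) (hX _) (hX _) hw hw'
  · refine (condMutualInfo_eq_zero_iff_famEntropy (hd (j, some 0)) (hd (j, some 2)) (hd (j, none))
      (isJointVar_single F _) (isJointVar_single F _) (isJointVar_single F _)).1 ?_
    refine (condMutualInfo_eq_zero_iff (hd (j, some 0)) (hd (j, some 2)) (hd (j, none))).2 ?_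
    exact (hdm j).condIndepVar_commonRep (hX _) (hX _) (hX _)

/-- The common parts of the copies are a model of the original implication. -/
theorem BoundedCI.Valid.holds_spread {R : BoundedCI} (h : R.Valid) {S : Fin (R.n * 3) → Type}
    [∀ i, Fintype (S i)] [∀ i, MeasurableSpace (S i)] [∀ i, MeasurableSingletonClass (S i)]
    {X : (i : Fin (R.n * 3)) → Ω → S i} (hmeas : ∀ i, Measurable (X i))
    (hcard : ∀ i, (Fintype.card (S i) : ℕ∞) ≤ R.bound i.divNat)
    (hmarkov : ∀ (j : Fin R.n) p, (markovTriple j p).Holds μ X)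
    (hant : ∀ t ∈ R.antecedents, t.spread.Holds μ X) : R.consequent.spread.Holds μ X := by
  have hX : ∀ i, IsDiscreteVar (X i) := fun i => IsDiscreteVar.of_measurable (hmeas i)
  set F := copiesWithCommon μ X with hF
  have hd : ∀ x, IsDiscreteVar (F x) := isDiscreteVar_copiesWithCommon hX
  have hN : IsNoisyCopy (famEntropy μ F) := isNoisyCopy_of_markovTriple hX hmarkov
  have hspread : ∀ t : CITriple R.n,
      t.spread.Holds μ X ↔ t.Holds μ fun j => F (j, none) := by
    intro t
    have hj : ∀ A : Finset (Fin R.n),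
        IsJointVar F (subVar (fun j => F (j, none)) A) (copyOf none A) := by
      intro A ω ω'
      simp only [subVar, funext_iff, Subtype.forall, mem_copyOf, Prod.forall]
      constructor
      · rintro h j _ ⟨hj, rfl⟩
        exact h j hj
      · intro h j hj
        exact h j none ⟨hj, rfl⟩
    rw [t.holds_iff F (fun j => hd _) (hj _) (hj _) (hj _), ← hN.condIndepFor_iff]
    refine t.spread.holds_iff F hX (isJointVar_copiesWithCommon X _ _ ?_)
      (isJointVar_copiesWithCommon X _ _ ?_) (isJointVar_copiesWithCommon X _ _ ?_) <;>
    · rintro ⟨i, l⟩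
      simp only [mem_copyOf, Bool.and_eq_true, decide_eq_true_eq]
      grind
  refine (hspread _).2 (h Ω μ (fun j => S (blockIdx j 0)) (fun j => F (j, none)) (fun j => ?_)
    (fun j => ?_) fun t ht => ?_)
  · exact fun s _ => hd (j, none) s
  · exact (hcard (blockIdx j 0)).trans_eq (congrArg R.bound (divNat_blockIdx j 0))
  · exact (hspread t).1 (hant t ht)

theorem BoundedCI.Valid.triplicate {R : BoundedCI} (h : R.Valid) : R.triplicate.Valid := by
  intro Ω _ μ _ S i1 i2 i3 X hmeas hcard hant
  exact @holds_spread Ω _ μ _ R h S i1 i2 i3 X hmeas hcard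
    (fun j p => hant _ (mem_antecedents_triplicate.2 (Or.inl ⟨j, p, rfl⟩)))
    (fun t ht => hant _ (mem_antecedents_triplicate.2 (Or.inr ⟨t, ht, rfl⟩)))

theorem BoundedCI.valid_triplicate_iff (R : BoundedCI) : R.Valid ↔ R.triplicate.Valid :=
  ⟨fun h => h.triplicate, valid_of_valid_triplicate⟩

end Reduction

/-! ### Stack programs -/

section StackProgram

open Turing

variable {K Λ : Type} [DecidableEq K]

/-- A stack program: in each step, the label determines a stack, one symbol is popped from it (if
there is one), and the outcome determines the symbols to be pushed and the next label, if any. -/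
structure StackProgram (K Λ : Type) where
  source : Λ → K
  action : Λ → Option CISym → List (K × CISym) × Option Λ

namespace StackProgram

/-- The symbols in the list are pushed one after the other. -/
def pushAll : List (K × CISym) → (K → List CISym) → K → List CISym
  | [], S => S
  | (k, a) :: l, S => pushAll l (Function.update S k (a :: S k))

theorem pushAll_append (l l' : List (K × CISym)) (S : K → List CISym) :
    pushAll (l ++ l') S = pushAll l' (pushAll l S) := by
  induction l generalizing S with
  | nil => rfl
  | cons a l ih => exact ih _

theorem pushAll_map (k : K) (l : List CISym) (S : K → List CISym) :
    pushAll (l.map fun a => (k, a)) S = Function.update S k (l.reverse ++ S k) := by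
  induction l generalizing S with
  | nil => simp [pushAll]
  | cons a l ih => simp [pushAll, ih]

/-- The statement that pushes a list of symbols, resets the internal state and passes to the next
label. -/
def finish : List (K × CISym) → Option Λ → TM2.Stmt (fun _ : K => CISym) Λ (Option CISym)
  | [], some l => .load (fun _ => none) (.goto fun _ => l)
  | [], none => .load (fun _ => none) .halt
  | (k, a) :: p, next => .push k (fun _ => a) (finish p next)

theorem stepAux_finish (p : List (K × CISym)) (next : Option Λ) (v : Option CISym)
    (S : K → List CISym) :
    TM2.stepAux (finish p next) v S = ⟨next, none, pushAll p S⟩ := by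
  induction p generalizing S with
  | nil => cases next <;> rfl
  | cons a p ih => exact ih _

/-- The code of a stack program. The internal state holds the popped symbol, and is `none` between
two steps. -/
def code (P : StackProgram K Λ) (l : Λ) : TM2.Stmt (fun _ : K => CISym) Λ (Option CISym) :=
  let act := fun o => finish (P.action l o).1 (P.action l o).2
  .pop (P.source l) (fun _ o => o) <|
    .branch (fun v => decide (v = some CISym.zero)) (act (some CISym.zero)) <|
    .branch (fun v => decide (v = some CISym.one)) (act (some CISym.one)) <|
    .branch (fun v => decide (v = some CISym.infty)) (act (some CISym.infty)) <|
    .branch (fun v => decide (v = some CISym.comma)) (act (some CISym.comma)) (act none)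

/-- A configuration between two steps. -/
def cfg (l : Option Λ) (S : K → List CISym) : TM2.Cfg (fun _ : K => CISym) Λ (Option CISym) :=
  ⟨l, none, S⟩

theorem step_code (P : StackProgram K Λ) (l : Λ) (S : K → List CISym) :
    TM2.step P.code (cfg (some l) S) =
      some (cfg (P.action l (S (P.source l)).head?).2
        (pushAll (P.action l (S (P.source l)).head?).1
          (Function.update S (P.source l) (S (P.source l)).tail))) := by
  unfold cfg
  rw [TM2.step, code, TM2.stepAux]
  rcases (S (P.source l)).head? with _ | a
  · exact congrArg some (stepAux_finish _ _ _ _)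
  · cases a <;> exact congrArg some (stepAux_finish _ _ _ _)

/-- The program passes from one configuration to another in at most `t` steps. -/
def ReachesIn (P : StackProgram K Λ) (t : ℕ) (a b : Option Λ × (K → List CISym)) : Prop :=
  ∃ s ≤ t, (flip bind (TM2.step P.code))^[s] (some (cfg a.1 a.2)) = some (cfg b.1 b.2)

namespace ReachesIn

variable {P : StackProgram K Λ} {a b c : Option Λ × (K → List CISym)} {s t : ℕ}

theorem trans (h1 : P.ReachesIn s a b) (h2 : P.ReachesIn t b c) : P.ReachesIn (s + t) a c := by
  obtain ⟨s', hs, h1⟩ := h1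
  obtain ⟨t', ht, h2⟩ := h2
  refine ⟨t' + s', by omega, ?_⟩
  rw [Function.iterate_add_apply, h1, h2]

theorem mono (h : P.ReachesIn s a b) (hst : s ≤ t) : P.ReachesIn t a b :=
  h.imp fun _ h => ⟨h.1.trans hst, h.2⟩

/-- A single step. -/
theorem single {l : Λ} {l' : Option Λ} {S S' : K → List CISym} {p : List (K × CISym)}
    (ha : P.action l (S (P.source l)).head? = (p, l'))
    (hS : pushAll p (Function.update S (P.source l) (S (P.source l)).tail) = S') :
    P.ReachesIn 1 (some l, S) (l', S') := by
  refine ⟨1, le_rfl, ?_⟩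
  have h := step_code P l S
  rw [ha, hS] at h
  exact h

/-- A single step, followed by further ones. -/
theorem head {l : Λ} {l' : Option Λ} {S S' : K → List CISym} {p : List (K × CISym)}
    {b' : Option Λ × (K → List CISym)} (ha : P.action l (S (P.source l)).head? = (p, l'))
    (hS : pushAll p (Function.update S (P.source l) (S (P.source l)).tail) = S')
    (h : P.ReachesIn t (l', S') b) (hb : b = b') : P.ReachesIn (t + 1) (some l, S) b' :=
  hb ▸ ((single ha hS).trans h).mono (by omega)

end ReachesIn

end StackProgram

end StackProgram

/-! ### The program -/

namespace Triplicate

open StackProgram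

/-- The stacks: input, output in reverse order, counter for the triples, counters for the positions
to the left and to the right of a cell (with two stacks each, between which a counter moves back and
forth when it is read), and three buffers for a cardinality bound. -/
inductive Stk
  | inp
  | out
  | cnt
  | lft (d : Bool)
  | rgt (d : Bool)
  | buf
  | fst
  | snd
  deriving DecidableEq, Fintype

/-- The labels of the program. -/
inductive Lab
  | readVars
  | readTriples
  | countMarkov
  | nextVar (d : Bool)
  | scanLeft (s : Fin 12) (d : Bool)
  | scanRight (s : Fin 12) (d : Bool)
  | nextTriple (d : Bool)
  | nextCell (q : Fin 3) (d : Bool)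
  | readBit (q : Fin 3) (d : Bool)
  | readBound
  | copyBound
  | writeFst
  | writeSnd
  | clear (d : Bool)
  | pour
  deriving Fintype

open Stk Lab

/-- The characteristic function of the `q`-th set of a triple `markovTriple j p` on the three
copies of the `i`-th variable; `here` tells whether `i = j`. -/
def markovBit (p : Fin 4) (q : Fin 3) (here : Bool) (k : Fin 3) : Bool :=
  match q with
  | 0 => here && decide (k = (copyPair p).1)
  | 1 => !here || (!decide (k = (copyPair p).1) && !decide (k = (copyPair p).2))
  | 2 => here && decide (k = (copyPair p).2)

/-- The part of a characteristic vector that belongs to the three copies of one variable. The number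
`s` runs through the three sets of the four triples for a variable. -/
def markovCell (s : Fin 12) (here : Bool) : List CISym :=
  (List.finRange 3).map fun k =>
    CISym.ofBool (markovBit ⟨s / 3, by omega⟩ ⟨s % 3, by omega⟩ here k)

/-- The bit of a characteristic vector, placed on the `q`-th of three copies. -/
def spreadCell (q : Fin 3) (b : CISym) : List CISym :=
  (List.finRange 3).map fun k => if k = q then b else CISym.zero

/-- Symbols to be appended to the output. -/
def emit (l : List CISym) : List (Stk × CISym) :=
  l.map fun a => (out, a)

/-- The stack a label pops from. -/
def source : Lab → Stk
  | readVars => inp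
  | readTriples => inp
  | countMarkov => rgt false
  | nextVar d => rgt d
  | scanLeft _ d => lft d
  | scanRight _ d => rgt d
  | nextTriple _ => cnt
  | nextCell _ d => lft d
  | readBit _ _ => inp
  | readBound => inp
  | copyBound => buf
  | writeFst => fst
  | writeSnd => snd
  | clear d => lft d
  | pour => out

/-- The action of a label on the popped symbol. On inputs that are not strings of instances the
program may stop early. -/
def action : Lab → Option CISym → List (Stk × CISym) × Option Lab
  | readVars, some .one =>
    (emit (List.replicate 3 .one) ++ [(rgt false, .one)], some readVars)
  | readVars, some .comma => (emit [.comma], some readTriples)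
  | readVars, _ => ([], none)
  | readTriples, some .one => (emit [.one] ++ [(cnt, .one)], some readTriples)
  | readTriples, some .comma => ([(cnt, .one)], some countMarkov)
  | readTriples, _ => ([], none)
  | countMarkov, some _ =>
    (emit (List.replicate 4 .one) ++ [(rgt true, .one)], some countMarkov)
  | countMarkov, none => (emit [.comma], some (nextVar true))
  | nextVar d, some _ => ([], some (scanLeft 0 d))
  | nextVar d, none => ([], some (nextTriple d))
  | scanLeft s d, some _ =>
    (emit (markovCell s false) ++ [(lft !d, .one)], some (scanLeft s d))
  | scanLeft s d, none => (emit (markovCell s true), some (scanRight s d))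
  | scanRight s d, some _ =>
    (emit (markovCell s false) ++ [(rgt !d, .one)], some (scanRight s d))
  | scanRight s d, none =>
    if s = 11 then ([(lft !d, .one)], some (nextVar !d)) else ([], some (scanLeft (s + 1) !d))
  | nextTriple d, some _ => ([], some (nextCell 0 d))
  | nextTriple _, none => ([], some readBound)
  | nextCell q d, some _ => ([(lft !d, .one)], some (readBit q d))
  | nextCell q d, none => ([], some (if q = 2 then nextTriple !d else nextCell (q + 1) !d))
  | readBit q d, some b => (emit (spreadCell q b), some (nextCell q d))
  | readBit _ _, none => ([], none)
  | readBound, some .comma => (emit [.comma], some copyBound)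
  | readBound, some a => (emit [a] ++ [(buf, a)], some readBound)
  | readBound, none => ([], some (clear false))
  | copyBound, some a => ([(fst, a), (snd, a)], some copyBound)
  | copyBound, none => ([], some writeFst)
  | writeFst, some a => (emit [a], some writeFst)
  | writeFst, none => (emit [.comma], some writeSnd)
  | writeSnd, some a => (emit [a], some writeSnd)
  | writeSnd, none => (emit [.comma], some readBound)
  | clear d, some _ => ([], some (clear d))
  | clear d, none => ([], some (if d then pour else clear true))
  | pour, some a => ([(inp, a)], some pour)
  | pour, none => ([], none)

/-- The program that computes `BoundedCI.triplicate` on strings. -/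
def program : StackProgram Stk Lab where
  source := source
  action := action

/-- The contents of all stacks. -/
def stk (i o c : List CISym) (l r : Bool → List CISym) (w w1 w2 : List CISym) : Stk → List CISym
  | inp => i
  | out => o
  | cnt => c
  | lft d => l d
  | rgt d => r d
  | buf => w
  | fst => w1
  | snd => w2

/-- The contents of a pair of stacks, the first list being on the stack with index `d`. -/
def two (d : Bool) (a b : List CISym) (e : Bool) : List CISym :=
  if e = d then a else b

/-- A counter with the value `n`. -/
def ones (n : ℕ) : List CISym :=
  List.replicate n CISym.one

theorem ones_succ (n : ℕ) : ones (n + 1) = CISym.one :: ones n := rfl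

@[simp] theorem ones_zero : ones 0 = [] := rfl

/-! ### Simulation of the program -/

section Simulation

variable {i o c w w1 w2 x a b : List CISym} {l r : Bool → List CISym} {d : Bool}

@[simp] theorem two_same : two d a b d = a := by simp [two]

@[simp] theorem two_not : two d a b (!d) = b := by simp [two]

@[simp] theorem update_two_same : Function.update (two d a b) d x = two d x b := by
  ext e : 1
  by_cases h : e = d <;> simp [two, h]

@[simp] theorem update_two_not : Function.update (two d a b) (!d) x = two d a x := by
  ext e : 1
  cases e <;> cases d <;> simp [two]

theorem two_swap : two (!d) a b = two d b a := by
  ext e : 1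
  cases e <;> cases d <;> simp [two]

@[simp] theorem stk_inp : stk i o c l r w w1 w2 inp = i := rfl
@[simp] theorem stk_out : stk i o c l r w w1 w2 out = o := rfl
@[simp] theorem stk_cnt : stk i o c l r w w1 w2 cnt = c := rfl
@[simp] theorem stk_lft : stk i o c l r w w1 w2 (lft d) = l d := rfl
@[simp] theorem stk_rgt : stk i o c l r w w1 w2 (rgt d) = r d := rfl
@[simp] theorem stk_buf : stk i o c l r w w1 w2 buf = w := rfl
@[simp] theorem stk_fst : stk i o c l r w w1 w2 fst = w1 := rfl
@[simp] theorem stk_snd : stk i o c l r w w1 w2 snd = w2 := rfl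

@[simp] theorem update_inp :
    Function.update (stk i o c l r w w1 w2) inp x = stk x o c l r w w1 w2 := by
  ext k : 1; cases k <;> simp

@[simp] theorem update_out :
    Function.update (stk i o c l r w w1 w2) out x = stk i x c l r w w1 w2 := by
  ext k : 1; cases k <;> simp

@[simp] theorem update_cnt :
    Function.update (stk i o c l r w w1 w2) cnt x = stk i o x l r w w1 w2 := by
  ext k : 1; cases k <;> simp

@[simp] theorem update_lft : Function.update (stk i o c l r w w1 w2) (lft d) x =
    stk i o c (Function.update l d x) r w w1 w2 := by
  ext k : 1; cases k <;> simp [Function.update_apply]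

@[simp] theorem update_rgt : Function.update (stk i o c l r w w1 w2) (rgt d) x =
    stk i o c l (Function.update r d x) w w1 w2 := by
  ext k : 1; cases k <;> simp [Function.update_apply]

@[simp] theorem update_buf :
    Function.update (stk i o c l r w w1 w2) buf x = stk i o c l r x w1 w2 := by
  ext k : 1; cases k <;> simp

@[simp] theorem update_fst :
    Function.update (stk i o c l r w w1 w2) fst x = stk i o c l r w x w2 := by
  ext k : 1; cases k <;> simp

@[simp] theorem update_snd :
    Function.update (stk i o c l r w w1 w2) snd x = stk i o c l r w w1 x := by
  ext k : 1; cases k <;> simp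

@[simp] theorem pushAll_emit (S : Stk → List CISym) :
    pushAll (emit x) S = Function.update S out (x.reverse ++ S out) :=
  pushAll_map _ _ _

theorem replicate_append_cons (n : ℕ) (y : CISym) (x : List CISym) :
    List.replicate n y ++ y :: x = y :: (List.replicate n y ++ x) := by
  induction n with
  | zero => rfl
  | succ n ih => rw [List.replicate_succ, List.cons_append, ih, List.cons_append]

/-- The unary number `n` is read. The output is in reverse order, since it is a stack. -/
theorem readVars_loop (n b : ℕ) (o : List CISym) :
    program.ReachesIn (n + 1)
      (some readVars, stk (encodeUnary n ++ i) o c l (two false (ones b) []) w w1 w2)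
      (some readTriples, stk i ((encodeUnary (n * 3)).reverse ++ o) c l
        (two false (ones (n + b)) []) w w1 w2) := by
  induction n generalizing o b with
  | zero =>
    refine .single (p := emit [.comma]) rfl ?_
    simp [program, source, encodeUnary]
  | succ n ih =>
    refine .head (p := emit (List.replicate 3 .one) ++ [(rgt false, .one)]) rfl ?_
      (ih (b + 1) (List.replicate 3 .one ++ o)) ?_
    · simp [program, source, encodeUnary, pushAll_append, pushAll, ones_succ]
    · have e : n + (b + 1) = n + 1 + b := by omega
      simp [encodeUnary, e, List.replicate_add, Nat.succ_mul, replicate_append_cons]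

/-- The unary number `m` is read; the counter for the triples becomes `m + 1`, because of the
consequent. -/
theorem readTriples_loop (m b : ℕ) (o : List CISym) :
    program.ReachesIn (m + 1)
      (some readTriples, stk (encodeUnary m ++ i) o (ones b) l r w w1 w2)
      (some countMarkov, stk i (ones m ++ o) (ones (m + b + 1)) l r w w1 w2) := by
  induction m generalizing o b with
  | zero =>
    refine .single (p := [(cnt, .one)]) rfl ?_
    simp [program, source, encodeUnary, pushAll, ones_succ]
  | succ m ih =>
    refine .head (p := emit [.one] ++ [(cnt, .one)]) rfl ?_ (ih (b + 1) (.one :: o)) ?_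
    · simp [program, source, encodeUnary, pushAll_append, pushAll, ones_succ,
        List.replicate_succ]
    · have e : m + (b + 1) + 1 = m + 1 + b + 1 := by omega
      simp [e, ones, List.replicate_succ']

/-- The number of antecedents is completed by the `4 n` new ones. -/
theorem countMarkov_loop (n b : ℕ) (o : List CISym) :
    program.ReachesIn (n + 1)
      (some countMarkov, stk i o c l (two false (ones n) (ones b)) w w1 w2)
      (some (nextVar true), stk i (.comma :: ones (n * 4) ++ o) c l
        (two true (ones (n + b)) []) w w1 w2) := by
  induction n generalizing o b with
  | zero =>
    refine .single (p := emit [.comma]) rfl ?_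
    have e : two false [] (ones b) = two true (ones b) [] := (two_swap (d := false)).symm
    simp [program, source]
    rw [e]
  | succ n ih =>
    refine .head (p := emit (List.replicate 4 .one) ++ [(rgt true, .one)]) rfl ?_
      (ih (b + 1) (List.replicate 4 .one ++ o)) ?_
    · have e : true = !false := rfl
      simp [program, source, pushAll_append, pushAll, ones_succ, e, -Bool.not_false]
    · have e : n + (b + 1) = n + 1 + b := by omega
      simp [e, ones, Nat.succ_mul, List.replicate_add]

/-- The characteristic vector of the set with number `s`, for the variable with `u` variables to
its left and `v` to its right. -/
def markovVec (s : Fin 12) (u v : ℕ) : List CISym :=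
  (List.replicate u (markovCell s false)).flatten ++ markovCell s true ++
    (List.replicate v (markovCell s false)).flatten

theorem scanLeft_loop (s : Fin 12) (u b : ℕ) (o : List CISym) :
    program.ReachesIn (u + 1)
      (some (scanLeft s d), stk i o c (two d (ones u) (ones b)) r w w1 w2)
      (some (scanRight s d), stk i (((List.replicate u (markovCell s false)).flatten ++
        markovCell s true).reverse ++ o) c (two d [] (ones (u + b))) r w w1 w2) := by
  induction u generalizing o b with
  | zero =>
    refine .single (p := emit (markovCell s true)) (by simp [program, source, action]) ?_
    simp [program, source]
  | succ u ih =>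
    refine .head (p := emit (markovCell s false) ++ [(lft !d, .one)])
      (by simp [program, source, action, ones_succ]) ?_
      (ih (b + 1) ((markovCell s false).reverse ++ o)) ?_
    · simp [program, source, pushAll_append, pushAll, ones_succ]
    · have e : u + (b + 1) = u + 1 + b := by omega
      simp [e, List.replicate_succ]

theorem scanRight_loop (s : Fin 12) (v b : ℕ) (o : List CISym) :
    program.ReachesIn v
      (some (scanRight s d), stk i o c l (two d (ones v) (ones b)) w w1 w2)
      (some (scanRight s d), stk i ((List.replicate v (markovCell s false)).flatten.reverse ++ o) c
        l (two d [] (ones (v + b))) w w1 w2) := by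
  induction v generalizing o b with
  | zero => exact ⟨0, le_rfl, by simp⟩
  | succ v ih =>
    refine .head (p := emit (markovCell s false) ++ [(rgt !d, .one)])
      (by simp [program, source, action, ones_succ]) ?_
      (ih (b + 1) ((markovCell s false).reverse ++ o)) ?_
    · simp [program, source, pushAll_append, pushAll, ones_succ]
    · have e : v + (b + 1) = v + 1 + b := by omega
      simp [e, List.replicate_succ]

/-- The set with number `s` is written; the two counters end up on the other pair of stacks. -/
theorem scan (s : Fin 12) (u v : ℕ) (o : List CISym) :
    program.ReachesIn (u + 1 + v)
      (some (scanLeft s d), stk i o c (two d (ones u) []) (two d (ones v) []) w w1 w2)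
      (some (scanRight s d), stk i ((markovVec s u v).reverse ++ o) c (two d [] (ones u))
        (two d [] (ones v)) w w1 w2) := by
  have h1 := scanLeft_loop (i := i) (c := c) (r := two d (ones v) []) (w := w) (w1 := w1)
    (w2 := w2) (d := d) s u 0 o
  have h := h1.trans (scanRight_loop s v 0 _)
  simpa [markovVec] using h

/-- The sets with numbers `s, …, 11` for a single variable. -/
theorem scan_from (u v : ℕ) (s : Fin 12) : ∀ (d : Bool) (o : List CISym),
    ∃ d' : Bool, program.ReachesIn ((12 - s) * (u + v + 2))
      (some (scanLeft s d), stk i o c (two d (ones u) []) (two d (ones v) []) w w1 w2)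
      (some (nextVar d'), stk i
        ((((List.finRange 12).drop s).flatMap fun s => markovVec s u v).reverse ++ o) c
        (two d' (ones (u + 1)) []) (two d' (ones v) []) w w1 w2) := by
  induction s using Fin.reverseInduction with
  | last =>
    intro d o
    have h1 := (scan (i := i) (c := c) (w := w) (w1 := w1) (w2 := w2) (d := d) 11 u v o).trans
      (ReachesIn.single (l := scanRight 11 d) (l' := some (nextVar !d)) (p := [(lft !d, .one)])
        (S' := stk i ((markovVec 11 u v).reverse ++ o) c (two (!d) (ones (u + 1)) [])
          (two (!d) (ones v) []) w w1 w2) (by simp [program, source, action])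
        (by simp [program, source, pushAll, two_swap, ones_succ]))
    have e : (List.finRange 12).drop (Fin.last 11).val = [11] := by decide
    refine ⟨!d, ?_⟩
    rw [e, List.flatMap_singleton]
    refine h1.mono ?_
    simp only [Fin.val_last]
    omega
  | cast s ih =>
    intro d o
    obtain ⟨d', h⟩ := ih (!d) ((markovVec s.castSucc u v).reverse ++ o)
    refine ⟨d', ?_⟩
    have h1 := (scan (i := i) (c := c) (w := w) (w1 := w1) (w2 := w2) (d := d) s.castSucc u v
      o).trans (.head (l := scanRight s.castSucc d) (p := []) ?_ ?_ h rfl)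
    · have e : (List.finRange 12).drop s.castSucc =
          s.castSucc :: (List.finRange 12).drop s.succ := by
        fin_cases s <;> decide
      rw [e]
      simp only [List.flatMap_cons, List.reverse_append, List.append_assoc]
      refine h1.mono ?_
      have hs : s.val < 11 := s.isLt
      have e2 : 12 - s.castSucc.val = (12 - s.succ.val) + 1 := by
        simp only [Fin.val_castSucc, Fin.val_succ]
        omega
      rw [e2, Nat.add_mul]
      omega
    · have h1 : s.castSucc ≠ 11 := by fin_cases s <;> decide
      have h2 : s.castSucc + 1 = s.succ := by fin_cases s <;> decide
      simp [program, source, action, h1, h2]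
    · simp [program, source, pushAll, two_swap]

theorem two_nil : two d [] [] = fun _ => [] := by
  ext e : 1
  simp [two]

/-- The characteristic vectors of the four triples `markovTriple j p`, when there are `n` variables
and `j` has the value `u`. -/
def markovWord (n u : ℕ) : List CISym :=
  (List.finRange 12).flatMap fun s => markovVec s u (n - 1 - u)

/-- The triples `markovTriple j p` are written, for the last `v` values of `j`. -/
theorem nextVar_loop (n v : ℕ) : ∀ (u : ℕ) (d : Bool) (o : List CISym), u + v = n →
    ∃ d' : Bool, program.ReachesIn (v * (12 * (n + 1) + 1) + 1)
      (some (nextVar d), stk i o c (two d (ones u) []) (two d (ones v) []) w w1 w2)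
      (some (nextTriple d'), stk i
        (((List.range v).flatMap fun t => markovWord n (u + t)).reverse ++ o) c
        (two d' (ones n) []) (fun _ => []) w w1 w2) := by
  induction v with
  | zero =>
    rintro u d o rfl
    refine ⟨d, ReachesIn.mono (.single (p := []) (by simp [program, source, action]) ?_)
      (by omega)⟩
    simp [program, source, pushAll, two_nil]
  | succ v ih =>
    intro u d o huv
    obtain ⟨d1, h1⟩ := scan_from (i := i) (c := c) (w := w) (w1 := w1) (w2 := w2) u v 0 d o
    obtain ⟨d2, h2⟩ := ih (u + 1) d1 ((markovWord n u).reverse ++ o) (by omega)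
    have e : n - 1 - u = v := by omega
    have h3 := h1.trans (t := v * (12 * (n + 1) + 1) + 1) (by simpa [markovWord, e] using h2)
    refine ⟨d2, ReachesIn.mono (.head (p := []) (by simp [program, source, action, ones_succ]) ?_
      h3 ?_) ?_⟩
    · simp [program, source, pushAll, ones_succ]
    · have e1 : ∀ t, u + 1 + t = u + (t + 1) := fun t => by omega
      simp [List.range_succ_eq_map, List.flatMap_map, e1, markovWord, e]
    · have e2 : u + v + 2 = n + 1 := by omega
      simp only [Fin.val_zero, e2, Nat.add_mul]
      omega

/-- A part `x` of a characteristic vector is read and placed on the `q`-th copies; the counter tells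
where the vector ends. -/
theorem readBit_loop (q : Fin 3) (x : List CISym) (b : ℕ) (o : List CISym) :
    program.ReachesIn (2 * x.length)
      (some (nextCell q d), stk (x ++ i) o c (two d (ones x.length) (ones b)) r w w1 w2)
      (some (nextCell q d), stk i ((x.flatMap (spreadCell q)).reverse ++ o) c
        (two d [] (ones (x.length + b))) r w w1 w2) := by
  induction x generalizing o b with
  | nil => exact ⟨0, le_rfl, by simp⟩
  | cons y x ih =>
    refine ReachesIn.mono (.head (p := [(lft !d, .one)]) (l' := some (readBit q d))
      (S' := stk (y :: (x ++ i)) o c (two d (ones x.length) (ones (b + 1))) r w w1 w2)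
      (by simp [program, source, action, ones_succ]) ?_
      (.head (p := emit (spreadCell q y)) rfl ?_
        (ih (b + 1) ((spreadCell q y).reverse ++ o)) ?_) rfl) (s := 2 * x.length + 1 + 1) ?_
    · simp [program, source, pushAll, ones_succ]
    · simp [program, source]
    · have e : x.length + (b + 1) = x.length + 1 + b := by omega
      simp [e]
    · simp
      omega

theorem nextCell_end (q : Fin 3) (x : List CISym) (o : List CISym) :
    program.ReachesIn (2 * x.length + 1)
      (some (nextCell q d), stk (x ++ i) o c (two d (ones x.length) []) r w w1 w2)
      (some (if q = 2 then nextTriple !d else nextCell (q + 1) !d),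
        stk i ((x.flatMap (spreadCell q)).reverse ++ o) c
        (two (!d) (ones x.length) []) r w w1 w2) := by
  have h := readBit_loop (i := i) (c := c) (r := r) (w := w) (w1 := w1) (w2 := w2) (d := d) q x 0 o
  refine h.trans (.single (p := []) (by simp [program, source, action]) ?_)
  simp [program, source, pushAll, two_swap]

/-- The string of the triple `t.spread`. -/
def spreadWord {n : ℕ} (t : CITriple n) : List CISym :=
  (encodeSubset t.A).flatMap (spreadCell 0) ++ (encodeSubset t.B).flatMap (spreadCell 1) ++
    (encodeSubset t.C).flatMap (spreadCell 2)

theorem readTriple {n : ℕ} (t : CITriple n) (o : List CISym) :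
    program.ReachesIn (6 * n + 3)
      (some (nextCell 0 d), stk (encodeTriple t ++ i) o c (two d (ones n) []) r w w1 w2)
      (some (nextTriple !d), stk i ((spreadWord t).reverse ++ o) c
        (two (!d) (ones n) []) r w w1 w2) := by
  have len : ∀ A : Finset (Fin n), (encodeSubset A).length = n := fun A => by simp [encodeSubset]
  have key : ∀ (q : Fin 3) (A : Finset (Fin n)) (i o : List CISym) (d : Bool),
      program.ReachesIn (2 * n + 1)
      (some (nextCell q d), stk (encodeSubset A ++ i) o c (two d (ones n) []) r w w1 w2)
      (some (if q = 2 then nextTriple !d else nextCell (q + 1) !d),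
        stk i (((encodeSubset A).flatMap (spreadCell q)).reverse ++ o) c
        (two (!d) (ones n) []) r w w1 w2) := by
    intro q A i o d
    simpa only [len] using nextCell_end (i := i) (c := c) (r := r) (w := w) (w1 := w1) (w2 := w2)
      (d := d) q (encodeSubset A) o
  have h := ((key 0 t.A (encodeSubset t.B ++ (encodeSubset t.C ++ i)) o d).trans
    (key 1 t.B _ _ _)).trans (key 2 t.C _ _ _)
  simp only [Bool.not_not, if_pos] at h
  refine ReachesIn.mono ?_ (s := 2 * n + 1 + (2 * n + 1) + (2 * n + 1)) (by omega)
  simpa [encodeTriple, spreadWord] using h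

theorem nextTriple_loop {n : ℕ} (ts : List (CITriple n)) : ∀ (d : Bool) (o : List CISym),
    ∃ d' : Bool, program.ReachesIn (ts.length * (6 * n + 4) + 1)
      (some (nextTriple d), stk (ts.flatMap encodeTriple ++ i) o (ones ts.length)
        (two d (ones n) []) r w w1 w2)
      (some readBound, stk i ((ts.flatMap spreadWord).reverse ++ o) []
        (two d' (ones n) []) r w w1 w2) := by
  induction ts with
  | nil =>
    intro d o
    refine ⟨d, ReachesIn.mono (.single (p := []) rfl ?_) (by omega)⟩
    simp [program, source, pushAll]
  | cons t ts ih =>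
    intro d o
    obtain ⟨d', h⟩ := ih (!d) ((spreadWord t).reverse ++ o)
    refine ⟨d', ReachesIn.mono (.head (p := []) (S' := stk (encodeTriple t ++
      (ts.flatMap encodeTriple ++ i)) o (ones ts.length) (two d (ones n) []) r w w1 w2) rfl ?_
      ((readTriple t o).trans h) ?_) ?_⟩
    · simp [program, source, pushAll, ones_succ]
    · simp
    · rw [List.length_cons, Nat.add_mul]
      omega

theorem readBound_loop (u : List CISym) (hu : CISym.comma ∉ u) (o w : List CISym) :
    program.ReachesIn (u.length + 1)
      (some readBound, stk (u ++ .comma :: i) o c l r w w1 w2)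
      (some copyBound, stk i (.comma :: u.reverse ++ o) c l r (u.reverse ++ w) w1 w2) := by
  induction u generalizing o w with
  | nil =>
    refine .single (p := emit [.comma]) rfl ?_
    simp [program, source]
  | cons y u ih =>
    simp only [List.mem_cons, not_or] at hu
    refine .head (p := emit [y] ++ [(buf, y)]) (l' := some readBound) ?_ ?_
      (ih hu.2 (y :: o) (y :: w)) ?_
    · cases y
      · rfl
      · rfl
      · rfl
      · exact absurd rfl hu.1
    · simp [program, source, pushAll_append, pushAll]
    · simp

theorem copyBound_loop (u w1 w2 : List CISym) :
    program.ReachesIn (u.length + 1)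
      (some copyBound, stk i o c l r u w1 w2)
      (some writeFst, stk i o c l r [] (u.reverse ++ w1) (u.reverse ++ w2)) := by
  induction u generalizing w1 w2 with
  | nil =>
    refine .single (p := []) rfl ?_
    simp [program, source, pushAll]
  | cons y u ih =>
    refine .head (p := [(fst, y), (snd, y)]) rfl ?_ (ih (y :: w1) (y :: w2)) ?_
    · simp [program, source, pushAll]
    · simp

theorem writeFst_loop (u o : List CISym) :
    program.ReachesIn (u.length + 1)
      (some writeFst, stk i o c l r w u w2)
      (some writeSnd, stk i (.comma :: u.reverse ++ o) c l r w [] w2) := by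
  induction u generalizing o with
  | nil =>
    refine .single (p := emit [.comma]) rfl ?_
    simp [program, source]
  | cons y u ih =>
    refine .head (p := emit [y]) rfl ?_ (ih (y :: o)) ?_
    · simp [program, source]
    · simp

theorem writeSnd_loop (u o : List CISym) :
    program.ReachesIn (u.length + 1)
      (some writeSnd, stk i o c l r w w1 u)
      (some readBound, stk i (.comma :: u.reverse ++ o) c l r w w1 []) := by
  induction u generalizing o with
  | nil =>
    refine .single (p := emit [.comma]) rfl ?_
    simp [program, source]
  | cons y u ih =>
    refine .head (p := emit [y]) rfl ?_ (ih (y :: o)) ?_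
    · simp [program, source]
    · simp

/-- Each cardinality bound is read and written three times. -/
theorem readBounds (us : List (List CISym)) (hus : ∀ u ∈ us, CISym.comma ∉ u) (o : List CISym) :
    program.ReachesIn (4 * (us.flatMap fun u => u ++ [CISym.comma]).length + 1)
      (some readBound, stk (us.flatMap fun u => u ++ [CISym.comma]) o c l r [] [] [])
      (some (clear false), stk [] ((us.flatMap fun u =>
        (List.replicate 3 (u ++ [CISym.comma])).flatten).reverse ++ o) c l r [] [] []) := by
  induction us generalizing o with
  | nil =>
    refine .single (p := []) rfl ?_
    simp [program, source, pushAll]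
  | cons u us ih =>
    simp only [List.mem_cons, forall_eq_or_imp] at hus
    have h1 := readBound_loop (i := us.flatMap fun u => u ++ [CISym.comma]) (c := c) (l := l)
      (r := r) (w1 := []) (w2 := []) u hus.1 o []
    have h2 := (((h1.trans (copyBound_loop _ _ _)).trans (writeFst_loop _ _)).trans
      (writeSnd_loop _ _)).mono (t := 4 * (u.length + 1)) (by simp; omega)
    have h3 : program.ReachesIn (4 * (u.length + 1))
        (some readBound, stk ((u :: us).flatMap fun u => u ++ [CISym.comma]) o c l r [] [] [])
        (some readBound, stk (us.flatMap fun u => u ++ [CISym.comma])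
          ((List.replicate 3 (u ++ [CISym.comma])).flatten.reverse ++ o) c l r [] [] []) := by
      simpa [List.replicate_succ] using h2
    have h4 := (h3.trans (ih hus.2 _)).mono
      (t := 4 * ((u :: us).flatMap fun u => u ++ [CISym.comma]).length + 1) (by simp; omega)
    simpa [List.replicate_succ] using h4

theorem clear_loop (u : List CISym) (l : Bool → List CISym) (hl : l d = u) :
    program.ReachesIn (u.length + 1)
      (some (clear d), stk i o c l r w w1 w2)
      (some (if d then pour else clear true), stk i o c (Function.update l d []) r w w1 w2) := by
  induction u generalizing l with
  | nil =>
    refine .single (p := []) (by simp [program, source, action, hl]) ?_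
    simp [program, source, pushAll, hl]
  | cons y u ih =>
    refine .head (p := []) (by simp [program, source, action, hl]) ?_
      (ih (Function.update l d u) (by simp)) ?_
    · simp [program, source, pushAll, hl]
    · simp

theorem clear_all (l : Bool → List CISym) :
    program.ReachesIn ((l false).length + (l true).length + 2)
      (some (clear false), stk i o c l r w w1 w2)
      (some pour, stk i o c (fun _ => []) r w w1 w2) := by
  have h1 := clear_loop (i := i) (o := o) (c := c) (r := r) (w := w) (w1 := w1) (w2 := w2)
    (d := false) _ l rfl
  have h2 := h1.trans (clear_loop (d := true) (l true) (Function.update l false []) (by simp))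
  have e : Function.update (Function.update l false []) true [] = fun _ => [] := by
    ext e : 1
    cases e <;> simp
  rw [e] at h2
  exact h2.mono (by omega)

/-- The output is brought into the right order. -/
theorem pour_loop (o i : List CISym) :
    program.ReachesIn (o.length + 1)
      (some pour, stk i o c l r w w1 w2) (none, stk (o.reverse ++ i) [] c l r w w1 w2) := by
  induction o generalizing i with
  | nil =>
    refine .single (p := []) rfl ?_
    simp [program, source, pushAll]
  | cons y o ih =>
    refine .head (p := [(inp, y)]) rfl ?_ (ih (y :: i)) ?_
    · simp [program, source, pushAll]
    · simp

end Simulation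

/-! ### The strings of an implication and of its image -/

section Encoding

theorem ofFn_blocks {α : Type} {n : ℕ} (f : Fin (n * 3) → α) :
    List.ofFn f = (List.finRange n).flatMap fun j => (List.finRange 3).map fun k =>
      f (blockIdx j k) := by
  rw [List.ofFn_mul, List.flatMap_def, ← List.ofFn_eq_map]
  congr 2
  ext j : 1
  rw [← List.ofFn_eq_map]
  congr 1
  ext k : 1
  congr 1
  ext
  simp [blockIdx, finProdFinEquiv, Nat.mul_comm, Nat.add_comm]

theorem encodeSubset_blockSet {n : ℕ} (s : Fin n → Fin 3 → Bool) :
    encodeSubset (blockSet s) = (List.finRange n).flatMap fun j => (List.finRange 3).map fun k =>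
      CISym.ofBool (s j k) := by
  rw [encodeSubset, ofFn_blocks]
  simp only [mem_blockSet, divNat_blockIdx, modNat_blockIdx, Bool.decide_eq_true]

theorem encodeTriple_spread {n : ℕ} (t : CITriple n) :
    encodeTriple t.spread = spreadWord t := by
  have key : ∀ (q : Fin 3) (A : Finset (Fin n)),
      encodeSubset (blockSet fun j k => decide (j ∈ A) && decide (k = q)) =
        (encodeSubset A).flatMap (spreadCell q) := by
    intro q A
    rw [encodeSubset_blockSet, encodeSubset, List.ofFn_eq_map, List.flatMap_map]
    congr 1
    ext j : 1
    refine List.map_congr_left fun k _ => ?_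
    by_cases h : k = q <;> simp [h, CISym.ofBool]
  simp [encodeTriple, CITriple.spread, spreadWord, key]

/-- A word with a special cell at the position `j`. -/
theorem flatMap_finRange_ite {α : Type} (x y : List α) {n : ℕ} (j : Fin n) :
    ((List.finRange n).flatMap fun i => if i = j then x else y) =
      (List.replicate j y).flatten ++ x ++ (List.replicate (n - 1 - j) y).flatten := by
  induction n with
  | zero => exact j.elim0
  | succ n ih =>
    rw [List.finRange_succ, List.flatMap_cons, List.flatMap_map]
    refine Fin.cases ?_ (fun j => ?_) j
    · have h : ∀ i : Fin n, Fin.succ i ≠ 0 := Fin.succ_ne_zero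
      simp [h, List.flatMap_def]
    · have e : n + 1 - 1 - (j.succ : ℕ) = n - 1 - j := by
        rw [Fin.val_succ]
        omega
      have h : (0 : Fin (n + 1)) ≠ j.succ := (Fin.succ_ne_zero j).symm
      rw [e]
      simp only [h, if_false, Fin.succ_inj, ih j, Fin.val_succ, List.replicate_succ,
        List.flatten_cons, List.append_assoc]

theorem encodeSubset_markov {n : ℕ} (j : Fin n) (s : Fin 12) :
    encodeSubset (blockSet fun i k =>
      markovBit ⟨s / 3, by omega⟩ ⟨s % 3, by omega⟩ (decide (i = j)) k) =
      markovVec s j (n - 1 - j) := by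
  rw [encodeSubset_blockSet, markovVec, ← flatMap_finRange_ite]
  congr 1
  ext i : 1
  by_cases h : i = j <;> simp [h, markovCell]

theorem encodeTriple_markovTriple {n : ℕ} (j : Fin n) :
    ((List.finRange 4).flatMap fun p => encodeTriple (markovTriple j p)) = markovWord n j := by
  have e12 : List.finRange 12 = [0, 1, 2, 3, 4, 5, 6, 7, 8, 9, 10, 11] := by decide
  have e4 : List.finRange 4 = [0, 1, 2, 3] := by decide
  simp only [markovWord, e12, e4, List.flatMap_cons, List.flatMap_nil, ← encodeSubset_markov,
    List.append_nil, encodeTriple, List.append_assoc]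
  rfl

theorem flatMap_encodeTriple_triplicate (R : BoundedCI) :
    R.triplicate.triples.flatMap encodeTriple =
      (List.range R.n).flatMap (markovWord R.n) ++ R.triples.flatMap spreadWord := by
  have h1 : (List.range R.n).flatMap (markovWord R.n) =
      (List.finRange R.n).flatMap fun j : Fin R.n => markovWord R.n j := by
    rw [← List.map_coe_finRange_eq_range, List.flatMap_map]
  have h2 : R.triplicate.triples =
      ((List.finRange R.n).flatMap fun j => (List.finRange 4).map (markovTriple j)) ++
        R.triples.map CITriple.spread := by
    rw [BoundedCI.triples, BoundedCI.triples, List.map_append, ← List.append_assoc]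
    rfl
  refine (congrArg (List.flatMap (encodeTriple (n := R.n * 3))) h2).trans ?_
  rw [h1, List.flatMap_append, List.flatMap_assoc, List.flatMap_map]
  simp only [List.flatMap_map, encodeTriple_markovTriple, encodeTriple_spread]

theorem length_antecedents_triplicate (R : BoundedCI) :
    R.triplicate.antecedents.length = R.antecedents.length + R.n * 4 := by
  simp [BoundedCI.triplicate, List.length_flatMap]
  omega

/-- The string of a cardinality bound without the separator. -/
def boundWord (k : ℕ∞) : List CISym :=
  if k = ⊤ then [CISym.infty] else (Computability.encodeNat k.toNat).map CISym.ofBool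

theorem comma_notMem_boundWord (k : ℕ∞) : CISym.comma ∉ boundWord k := by
  unfold boundWord
  split_ifs
  · simp
  · rw [List.mem_map]
    rintro ⟨b, -, hb⟩
    cases b <;> simp [CISym.ofBool] at hb

theorem flatMap_encodeBound (R : BoundedCI) :
    (List.ofFn R.bound).flatMap encodeBound =
      ((List.ofFn R.bound).map boundWord).flatMap fun u => u ++ [CISym.comma] := by
  rw [List.flatMap_map]
  rfl

theorem flatMap_encodeBound_triplicate (R : BoundedCI) :
    (List.ofFn R.triplicate.bound).flatMap encodeBound =
      ((List.ofFn R.bound).map boundWord).flatMap fun u =>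
        (List.replicate 3 (u ++ [CISym.comma])).flatten := by
  have e : List.ofFn R.triplicate.bound = (List.finRange R.n).flatMap fun j =>
      List.replicate 3 (R.bound j) := by
    refine (ofFn_blocks (n := R.n) R.triplicate.bound).trans ?_
    congr 1
    ext j : 1
    have h : ∀ k, R.triplicate.bound (blockIdx j k) = R.bound j :=
      fun k => congrArg R.bound (divNat_blockIdx j k)
    simp only [h]
    rfl
  rw [e, List.flatMap_assoc, List.ofFn_eq_map, List.flatMap_map, List.flatMap_map]
  congr 1

theorem encode_eq (R : BoundedCI) :
    R.encode = encodeUnary R.n ++ (encodeUnary R.antecedents.length ++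
      (R.triples.flatMap encodeTriple ++
        (((List.ofFn R.bound).map boundWord).flatMap fun u => u ++ [CISym.comma]))) := by
  rw [BoundedCI.encode, flatMap_encodeBound, List.append_assoc, List.append_assoc]

theorem encode_triplicate (R : BoundedCI) :
    R.triplicate.encode = encodeUnary (R.n * 3) ++ (encodeUnary (R.antecedents.length + R.n * 4) ++
      ((List.range R.n).flatMap (markovWord R.n) ++ (R.triples.flatMap spreadWord ++
        (((List.ofFn R.bound).map boundWord).flatMap fun u =>
          (List.replicate 3 (u ++ [CISym.comma])).flatten)))) := by
  rw [BoundedCI.encode, flatMap_encodeBound_triplicate, flatMap_encodeTriple_triplicate,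
    length_antecedents_triplicate]
  simp only [List.append_assoc]
  rfl

end Encoding

/-! ### Running time -/

/-- The contents of the stacks when only the input stack is not empty. -/
def inputOnly (i : List CISym) : Stk → List CISym :=
  stk i [] [] (fun _ => []) (fun _ => []) [] [] []

theorem length_encodeTriple {n : ℕ} (t : CITriple n) : (encodeTriple t).length = 3 * n := by
  simp [encodeTriple, encodeSubset]
  omega

theorem length_encode (R : BoundedCI) :
    R.encode.length = (R.n + 1) + (R.antecedents.length + 1) +
      (R.antecedents.length + 1) * (3 * R.n) + ((List.ofFn R.bound).flatMap encodeBound).length := by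
  simp [BoundedCI.encode, encodeUnary, List.length_flatMap, length_encodeTriple, BoundedCI.triples]
  ring

theorem length_encode_triplicate (R : BoundedCI) :
    R.triplicate.encode.length = (R.n * 3 + 1) + (R.antecedents.length + R.n * 4 + 1) +
      (R.antecedents.length + R.n * 4 + 1) * (9 * R.n) +
        3 * ((List.ofFn R.bound).flatMap encodeBound).length := by
  rw [length_encode, length_antecedents_triplicate, flatMap_encodeBound_triplicate,
    flatMap_encodeBound]
  have h1 : R.triplicate.n = R.n * 3 := rfl
  simp only [h1, List.length_flatMap, List.length_flatten, List.map_replicate, List.sum_replicate,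
    smul_eq_mul, List.sum_map_mul_left]
  ring

/-- The program transforms the string of an implication into that of its image, in quadratic time. -/
theorem program_reachesIn (R : BoundedCI) :
    program.ReachesIn (200 * (R.encode.length + 1) ^ 2) (some readVars, inputOnly R.encode)
      (none, inputOnly R.triplicate.encode) := by
  have hlen : R.triples.length = R.antecedents.length + 1 := by simp [BoundedCI.triples]
  have h1 := readVars_loop (i := encodeUnary R.antecedents.length ++
      (R.triples.flatMap encodeTriple ++
        (((List.ofFn R.bound).map boundWord).flatMap fun u => u ++ [CISym.comma])))
    (c := []) (w := []) (w1 := []) (w2 := []) (l := fun _ => []) R.n 0 []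
  have h2 := (h1.trans (readTriples_loop R.antecedents.length 0 _)).trans (countMarkov_loop _ 0 _)
  obtain ⟨d1, h3⟩ := nextVar_loop (i := R.triples.flatMap encodeTriple ++
      (((List.ofFn R.bound).map boundWord).flatMap fun u => u ++ [CISym.comma]))
      (c := ones (R.antecedents.length + 0 + 1)) (w := []) (w1 := []) (w2 := []) R.n R.n 0 true
      (CISym.comma :: ones (R.n * 4) ++
        (ones R.antecedents.length ++ ((encodeUnary (R.n * 3)).reverse ++ []))) (by omega)
  have h4 := h2.trans (c := _) (t := R.n * (12 * (R.n + 1) + 1) + 1) (by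
    simpa only [ones_zero, two_nil, Nat.add_zero] using h3)
  obtain ⟨d2, h5⟩ := nextTriple_loop (i := ((List.ofFn R.bound).map boundWord).flatMap fun u =>
    u ++ [CISym.comma]) (r := fun _ => []) (w := []) (w1 := []) (w2 := []) R.triples d1
    ((((List.range R.n).flatMap fun t => markovWord R.n (0 + t)).reverse ++
      (CISym.comma :: ones (R.n * 4) ++
        (ones R.antecedents.length ++ ((encodeUnary (R.n * 3)).reverse ++ [])))))
  rw [hlen] at h5
  have h6 := ((h4.trans h5).trans (readBounds _ (by simp [comma_notMem_boundWord]) _)).trans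
    ((clear_all _).trans (pour_loop _ _))
  have e1 : inputOnly R.encode = stk (encodeUnary R.n ++ (encodeUnary R.antecedents.length ++
      (R.triples.flatMap encodeTriple ++
        (((List.ofFn R.bound).map boundWord).flatMap fun u => u ++ [CISym.comma]))))
      [] [] (fun _ => []) (two false (ones 0) []) [] [] [] := by
    rw [encode_eq, inputOnly, ones_zero, two_nil]
  have e2 : R.triplicate.encode = _ := encode_triplicate R
  rw [e1, inputOnly, e2]
  -- every term of the bound is at most quadratic in the length of the input
  have h7 := h6.mono (t := 200 * (R.encode.length + 1) ^ 2) ?_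
  · simpa [encodeUnary, ones] using h7
  · have e3 : ((((List.ofFn R.bound).map boundWord).flatMap fun u =>
        (List.replicate 3 (u ++ [CISym.comma])).flatten).reverse ++
          ((R.triples.flatMap spreadWord).reverse ++
            (((List.range R.n).flatMap fun t => markovWord R.n (0 + t)).reverse ++
              (CISym.comma :: ones (R.n * 4) ++
                (ones R.antecedents.length ++ ((encodeUnary (R.n * 3)).reverse ++ [])))))).length =
        R.triplicate.encode.length := by
      rw [e2, ← List.length_reverse]
      simp [encodeUnary, ones]
    have e4 : (two d2 (ones R.n) [] false).length + (two d2 (ones R.n) [] true).length = R.n := by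
      cases d2 <;> simp [two, ones]
    have hL := length_encode R
    rw [e3, e4, length_encode_triplicate, ← flatMap_encodeBound]
    generalize ((List.ofFn R.bound).flatMap encodeBound).length = k at *
    generalize R.encode.length = L at *
    generalize R.n = n, R.antecedents.length = m at hL ⊢
    have h9 : n * n ≤ L * L := Nat.mul_le_mul (by omega) (by omega)
    have h10 : 3 * (n * m) ≤ L := by rw [hL]; ring_nf; omega
    ring_nf
    ring_nf at hL h9 h10
    omega

open Turing

/-- The machine that runs the program; the stack `inp` serves for the input and for the output. -/
def machine : FinTM2 where
  K := Stk
  k₀ := inp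
  k₁ := inp
  Γ _ := CISym
  Λ := Lab
  main := readVars
  σ := Option CISym
  initialState := none
  Γk₀Fin := inferInstanceAs (Fintype CISym)
  m := program.code

theorem initList_machine (s : List CISym) :
    initList machine s = cfg (some readVars) (inputOnly s) := by
  unfold initList cfg
  congr 1
  ext k : 1
  cases k <;> rfl

theorem haltList_machine (s : List CISym) : haltList machine s = cfg none (inputOnly s) := by
  unfold haltList cfg
  congr 1
  ext k : 1
  cases k <;> rfl

theorem machine_outputs (R : BoundedCI) :
    Nonempty (TM2OutputsInTime machine R.encode (some R.triplicate.encode)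
      (200 * (R.encode.length + 1) ^ 2)) := by
  obtain ⟨s, hs, h⟩ := program_reachesIn R
  refine ⟨⟨⟨s, ?_⟩, hs⟩⟩
  rw [initList_machine]
  exact h.trans (congrArg some (haltList_machine _).symm)

/-- `BoundedCI.triplicate` is computable in polynomial time. -/
noncomputable def computableInPolyTime :
    TM2ComputableInPolyTime BoundedCI.encode BoundedCI.encode BoundedCI.triplicate where
  tm := machine
  inputAlphabet := Equiv.refl CISym
  outputAlphabet := Equiv.refl CISym
  time := 200 * (Polynomial.X + 1) ^ 2
  outputsFun R := by
    have e1 : R.encode.map (Equiv.refl CISym).invFun = R.encode := List.map_id _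
    have e2 : R.triplicate.encode.map (Equiv.refl CISym).invFun = R.triplicate.encode :=
      List.map_id _
    have e3 : (200 * (Polynomial.X + 1) ^ 2 : Polynomial ℕ).eval R.encode.length =
        200 * (R.encode.length + 1) ^ 2 := by simp
    rw [e3]
    exact e1.symm ▸ e2.symm ▸ (machine_outputs R).some

end Triplicate

theorem theorem3 :
    ∃ f : BoundedCI → BoundedCI,
      Nonempty (Turing.TM2ComputableInPolyTime BoundedCI.encode BoundedCI.encode f) ∧
      ∀ R : BoundedCI,
        (∀ t ∈ (f R).triples, t.IsDisjoint) ∧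
        (R.Valid ↔ (f R).Valid) ∧
        Set.range (f R).bound = Set.range R.bound :=
  ⟨BoundedCI.triplicate, ⟨Triplicate.computableInPolyTime⟩, fun R =>
    ⟨R.isDisjoint_triplicate, R.valid_triplicate_iff, R.range_bound_triplicate⟩⟩
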